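/- **Definitions.** An *oposet* $(I,\le,\perp)$ is a poset with a symmetric irreflexive relation $\perp$ such that $x\perp y$ implies that $x,y$ are not $\le$-comparable, and $x\le y$, $y\perp z$ imply $x\perp z$. A *quandle system* $(\mathcal I,\mathcal G,\mathcal A)$ consists of an oposet $\mathcal I=(I,\le,\perp)$, a family $\mathcal G=(G_i)_{i\in I}$ of non-trivial groups and, for every $k\in I$, an action of $G_k$ by automorphisms on the groupoid $\bigsqcup_{j<k}G_j$ (each $c\in G_k$ induces a permutation $j\mapsto c\ast j$ of $\{j\mid j<k\}$ and isomorphisms $G_j\to G_{c\ast j}$, $a\mapsto c\ast a$), with the convention $(bc)\ast a=c\ast(b\ast a)$ for $b,c\in G_k$, such that the induced actions on objects preserve $\le$ and $\perp$, and such that $c\ast(b\ast a)=(c\ast b)\ast(c\ast a)$ for all $i<j<k$, $a\in G_i$, $b\in G_j$, $c\in G_k$. The *quandle product* $\mathfrak Q=\mathfrak Q(\mathcal I,\mathcal G,\mathcal A)$ is the quotient of the free product $\ast_{i\in I}G_i$ by the relations $ab=ba$ for $a\in G_i$, $b\in G_j$, $i\perp j$, and $ab=b(b\ast a)$ for $a\in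 G_i$, $b\in G_j$, $i<j$. In a connected graph $X$ with graph distance $d$, a *median triple* of vertices $x_1,x_2,x_3$ is a triple of vertices $y_1,y_2,y_3$ with $d(x_i,x_j)=d(x_i,y_i)+d(y_i,y_j)+d(y_j,x_j)$ for all $i\ne j$. The graph $X$ is *quasi-median* if it is connected, has no induced subgraph isomorphic to $K_4^-$ (the complete graph $K_4$ minus an edge), and any three vertices admit a unique median triple of smallest perimeter $d(y_1,y_2)+d(y_2,y_3)+d(y_3,y_1)$, whose convex hull moreover is a product of complete graphs. A *clique* is a maximal complete subgraph, a *prism* of cubical dimension $n$ is an induced subgraph that is a product of $n$ cliques having at least two vertices each, and the *cubical dimension* of $X$ is the supremum in $\mathbb N\cup\{\infty\}$ of the cubical dimensions of its prisms. **Theorem.** For every quandle product $\mathfrak Q=\mathfrak Q(\mathcal I,\mathcal G,\mathcal A)$ the Cayley graph $\mathrm{Cayl}(\mathfrak Q,\bigcup\mathcal G)$ with respect to the union of the factors is a quasi-median graph, of cubical dimension at most $$\sup\{n\ge 0\mid \exists\, i_1,\dots,i_n\in I \text{ such that, for all } r\neq s,\ i_r<i_s \text{ or } i_s<i_r \text{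 or } i_r\perp i_s\}\in\mathbb N\cup\{\infty\}.$$ -/

import Mathlib

universe u v

/-! ## Oposets -/

/-- An oposet: a poset with a symmetric irreflexive orthogonality relation `Perp` such that
orthogonal elements are incomparable and orthogonality passes to smaller elements. -/
class Oposet (I : Type u) extends PartialOrder I where
  /-- Orthogonality. -/
  Perp : I → I → Prop
  perp_symm : ∀ x y : I, Perp x y → Perp y x
  perp_irrefl : ∀ x : I, ¬ Perp x x
  not_le_of_perp : ∀ x y : I, Perp x y → ¬ x ≤ y ∧ ¬ y ≤ x
  perp_of_le : ∀ x y z : I, x ≤ y → Perp y z → Perp x z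

/-! ## Quandle systems and quandle products -/

/-- A quandle system over the oposet `I` with factors `G i`.

For every `k`, the group `G k` acts by groupoid automorphisms on the disjoint union of the groups
`G j`, `j < k`: an element `c : G k` sends the object `j < k` to the object `obj c h < k`
(where `h : j < k`), and it sends `a : G j` to `c ∗ a = hom c h a : G (obj c h)`.
Equalities between elements of the disjoint union are equalities in `Σ i, G i`.

The actions follow the convention `(b * c) ∗ a = c ∗ (b ∗ a)`, which is the one compatible with the
defining relation `a * b = b * (b ∗ a)`, that is `b ∗ a = b⁻¹ * a * b`, of the quandle product. -/
structure QuandleSystem (I : Type u) [Oposet I] (G : I → Type v) [∀ i, Group (G i)] where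
  /-- The action of `G k` on the objects `j < k`. -/
  obj : ∀ {j k : I}, G k → j < k → I
  obj_lt : ∀ {j k : I} (c : G k) (h : j < k), obj c h < k
  /-- The action of `G k` on the groups `G j`, `j < k`. -/
  hom : ∀ {j k : I} (c : G k) (h : j < k), G j →* G (obj c h)
  one_act : ∀ {j k : I} (h : j < k) (a : G j),
    (⟨obj (1 : G k) h, hom (1 : G k) h a⟩ : Σ i, G i) = ⟨j, a⟩
  mul_act : ∀ {j k : I} (b c : G k) (h : j < k) (a : G j),
    (⟨obj (b * c) h, hom (b * c) h a⟩ : Σ i, G i) =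
      ⟨obj c (obj_lt b h), hom c (obj_lt b h) (hom b h a)⟩
  /-- The action on objects preserves the order. (Every `c` acts bijectively on objects, so that
  preserving `<` and preserving `≤` are the same.) -/
  obj_lt_obj : ∀ {i j k : I} (c : G k) (hi : i < k) (hj : j < k),
    i < j → obj c hi < obj c hj
  /-- The action on objects preserves orthogonality. -/
  obj_perp_obj : ∀ {i j k : I} (c : G k) (hi : i < k) (hj : j < k),
    Oposet.Perp i j → Oposet.Perp (obj c hi) (obj c hj)
  /-- The quandle relation `c ∗ (b ∗ a) = (c ∗ b) ∗ (c ∗ a)`. -/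
  quandle : ∀ {i j k : I} (hij : i < j) (hjk : j < k) (a : G i) (b : G j) (c : G k),
    (⟨obj c ((obj_lt b hij).trans hjk), hom c ((obj_lt b hij).trans hjk) (hom b hij a)⟩ :
        Σ i, G i) =
      ⟨obj (hom c hjk b) (obj_lt_obj c (hij.trans hjk) hjk hij),
        hom (hom c hjk b) (obj_lt_obj c (hij.trans hjk) hjk hij) (hom c (hij.trans hjk) a)⟩

namespace QuandleSystem

variable {I : Type u} [Oposet I] {G : I → Type v} [∀ i, Group (G i)]

open Monoid (CoprodI)

/-- The relators of the quandle product: `a * b = b * a` when the indices are orthogonal, and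
`a * b = b * (b ∗ a)` when the index of `a` is smaller than the index of `b`. -/
def relators (S : QuandleSystem I G) : Set (CoprodI G) :=
  {r | ∃ (i j : I) (_ : Oposet.Perp i j) (a : G i) (b : G j),
      r = (CoprodI.of a * CoprodI.of b) * (CoprodI.of b * CoprodI.of a)⁻¹} ∪
  {r | ∃ (i j : I) (h : i < j) (a : G i) (b : G j),
      r = (CoprodI.of a * CoprodI.of b) * (CoprodI.of b * CoprodI.of (S.hom b h a))⁻¹}

/-- The quandle product: the free product of the factors, modulo the relators. -/
abbrev Product (S : QuandleSystem I G) : Type (max u v) :=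
  CoprodI G ⧸ Subgroup.normalClosure S.relators

/-- The canonical map from a factor to the quandle product. -/
def of (S : QuandleSystem I G) (i : I) : G i →* S.Product :=
  (QuotientGroup.mk' (Subgroup.normalClosure S.relators)).comp CoprodI.of

/-- The Cayley graph of the quandle product with respect to the union of its factors. -/
def cayleyGraph (S : QuandleSystem I G) : SimpleGraph S.Product :=
  SimpleGraph.mulCayley (⋃ i, Set.range (S.of i))

end QuandleSystem

/-! ## Quasi-median graphs -/

namespace QuasiMedian

variable {V : Type u}

/-- The Cartesian product of a family of complete graphs, with vertex sets `α i`: two vertices are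
adjacent when they differ in exactly one coordinate. -/
def completeProduct {ι : Type v} (α : ι → Type u) : SimpleGraph (∀ i, α i) where
  Adj f g := ∃! i, f i ≠ g i
  symm := ⟨fun f g h => by simpa only [ne_comm] using h⟩
  loopless := ⟨fun f ⟨_, h, _⟩ => h rfl⟩

/-- A graph is a (finite) product of complete graphs. -/
def IsCompleteProduct (X : SimpleGraph V) : Prop :=
  ∃ (n : ℕ) (α : Fin n → Type u), Nonempty (X ≃g completeProduct α)

/-- A set of vertices is convex when it contains all the geodesics between its points. -/
def IsConvex (X : SimpleGraph V) (S : Set V) : Prop :=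
  ∀ x ∈ S, ∀ y ∈ S, ∀ z, X.dist x z + X.dist z y = X.dist x y → z ∈ S

/-- The convex hull of a set of vertices. -/
def hull (X : SimpleGraph V) (S : Set V) : Set V :=
  ⋂₀ {T | S ⊆ T ∧ IsConvex X T}

/-- `y` is a median triple of the three vertices `x`. -/
def IsMedianTriple (X : SimpleGraph V) (x y : Fin 3 → V) : Prop :=
  ∀ i j, i ≠ j →
    X.dist (x i) (x j) = X.dist (x i) (y i) + X.dist (y i) (y j) + X.dist (y j) (x j)

/-- The size of a triple of vertices. -/
noncomputable def perimeter (X : SimpleGraph V) (y : Fin 3 → V) : ℕ :=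
  X.dist (y 0) (y 1) + X.dist (y 1) (y 2) + X.dist (y 2) (y 0)

/-- `y` is a median triple of `x` that is as small as possible. -/
def IsSmallestMedianTriple (X : SimpleGraph V) (x y : Fin 3 → V) : Prop :=
  IsMedianTriple X x y ∧ ∀ z, IsMedianTriple X x z → perimeter X y ≤ perimeter X z

/-- Quasi-median graphs: connected graphs without induced `K₄⁻` (the complete graph on four
vertices minus an edge), in which any three vertices admit a unique smallest median triple, the
convex hull of which is a product of complete graphs. -/
structure IsQuasiMedian (X : SimpleGraph V) : Prop where
  connected : X.Connected
  no_induced_K4_minus : ∀ a b c d : V, X.Adj a b → X.Adj a c → X.Adj a d → X.Adj b c →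
    X.Adj b d → c ≠ d → X.Adj c d
  median_triple : ∀ x : Fin 3 → V, ∃ y : Fin 3 → V,
    (IsSmallestMedianTriple X x y ∧ ∀ y', IsSmallestMedianTriple X x y' → y' = y) ∧
    IsCompleteProduct (X.induce (hull X (Set.range y)))

/-- `X` contains a prism of cubical dimension `n`, that is, an induced subgraph that is a product
of `n` cliques of `X`. Cliques are maximal complete subgraphs, here with at least two vertices. -/
def HasPrism (X : SimpleGraph V) (n : ℕ) : Prop :=
  ∃ (α : Fin n → Type u) (φ : completeProduct α ↪g X), (∀ i, Nontrivial (α i)) ∧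
    ∀ (f : ∀ i, α i) (i : Fin n),
      Maximal X.IsClique (Set.range fun t : α i => φ (Function.update f i t))

/-- The cubical dimension of a graph: the supremum of the cubical dimensions of its prisms. -/
noncomputable def cubicalDimension (X : SimpleGraph V) : ℕ∞ :=
  ⨆ n ∈ {n : ℕ | HasPrism X n}, (n : ℕ∞)

end QuasiMedian

/-! The defining relations say that two letters whose indices are comparable or orthogonal can be
exchanged, one of them possibly being changed by the action. Length-two exchanges are consistent on
words of length three: `Swap.hexagon`, where the quandle relation enters. Hence "equal up to
exchanges" behaves as in a graph product of groups: front letters of equivalent words are equal or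
exchanged by one swap. Van der Waerden's argument, letting the quandle product act on reduced words
up to exchanges, then solves the word problem (`Reduced.wordEquiv`): reduced words of an element are
unique up to exchanges, and their length is the distance to the identity in the Cayley graph.

Inspecting front letters of reduced words yields the local conditions of `IsWeaklyModular`: the
triangle and quadrangle conditions and the absence of induced `K₄⁻` and `K₂,₃`. Two edges at a
vertex that span a square carry linked indices, which bounds the cubical dimension.

It remains to pass from the local conditions to quasi-medians. Every vertex has a unique nearest
point, its gate, in each clique. Cliques with the same gate fibres are parallel and play the role of
a hyperplane; the fibres are its sectors. Gates act as coordinates: betweenness can be tested in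
each clique (`btw_iff`), and sectors are themselves gated (`exists_sector_gate`). A smallest median
triple is therefore a tripod: a clique sees it as one point or as three. This determines its gates
from the given vertices, hence gives uniqueness. The parallelism classes separating a tripod are
pairwise transverse, so its hull is a power of the triangle. -/

set_option linter.unusedSectionVars false

/-! ### Letters and their exchange relations. -/

namespace QuandleSystem

variable {I : Type u} [Oposet I] {G : I → Type v} [∀ i, Group (G i)]

/-- Two indices are linked when they are distinct and comparable, or orthogonal. -/
def Linked (i j : I) : Prop := i < j ∨ j < i ∨ Oposet.Perp i j

/-- The inverse of a letter. -/
def letterInv (a : Σ i, G i) : Σ i, G i := ⟨a.1, a.2⁻¹⟩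

@[simp] lemma letterInv_fst (a : Σ i, G i) : (letterInv a).1 = a.1 := rfl

@[simp] lemma letterInv_letterInv (a : Σ i, G i) : letterInv (letterInv a) = a :=
  Sigma.ext rfl (heq_of_eq (inv_inv _))

lemma not_perp_of_lt {i j : I} (h : i < j) : ¬ Oposet.Perp i j :=
  fun hp => (Oposet.not_le_of_perp i j hp).1 h.le

lemma not_perp_of_gt {i j : I} (h : j < i) : ¬ Oposet.Perp i j :=
  fun hp => (Oposet.not_le_of_perp i j hp).2 h.le

lemma not_lt_of_perp {i j : I} (h : Oposet.Perp i j) : ¬ i < j := fun hl => not_perp_of_lt hl h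

lemma not_gt_of_perp {i j : I} (h : Oposet.Perp i j) : ¬ j < i := fun hl => not_perp_of_gt hl h

lemma Linked.symm {i j : I} (h : Linked i j) : Linked j i := by
  rcases h with h | h | h
  · exact Or.inr (Or.inl h)
  · exact Or.inl h
  · exact Or.inr (Or.inr (Oposet.perp_symm _ _ h))

lemma Linked.ne {i j : I} (h : Linked i j) : i ≠ j := by
  rintro rfl
  rcases h with h | h | h
  · exact lt_irrefl _ h
  · exact lt_irrefl _ h
  · exact Oposet.perp_irrefl _ h

variable (S : QuandleSystem I G)

open Classical in
/-- The action of the letter `b` on the letter `a`, extended trivially when the index of `a` is not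
smaller than the index of `b`. -/
noncomputable def star (b a : Σ i, G i) : Σ i, G i :=
  if h : a.1 < b.1 then ⟨S.obj b.2 h, S.hom b.2 h a.2⟩ else a

lemma star_of_lt {b a : Σ i, G i} (h : a.1 < b.1) :
    S.star b a = ⟨S.obj b.2 h, S.hom b.2 h a.2⟩ := dif_pos h

lemma star_of_not_lt {b a : Σ i, G i} (h : ¬ a.1 < b.1) : S.star b a = a := dif_neg h

lemma star_lt {b a : Σ i, G i} (h : a.1 < b.1) : (S.star b a).1 < b.1 := by
  rw [star_of_lt S h]; exact S.obj_lt _ _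

lemma star_mul {k : I} (b c : G k) (a : Σ i, G i) :
    S.star ⟨k, b * c⟩ a = S.star ⟨k, c⟩ (S.star ⟨k, b⟩ a) := by
  by_cases h : a.1 < k
  · have h' : (S.star ⟨k, b⟩ a).1 < k := S.star_lt (b := ⟨k, b⟩) h
    have e := S.star_of_lt (b := ⟨k, b⟩) h
    rw [S.star_of_lt (b := ⟨k, b * c⟩) h, S.mul_act b c h a.2, e]
    exact (S.star_of_lt (b := ⟨k, c⟩) (a := ⟨S.obj b h, S.hom b h a.2⟩) (S.obj_lt b h)).symm
  · rw [star_of_not_lt, star_of_not_lt, star_of_not_lt]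
    · exact h
    · rw [star_of_not_lt]
      · exact h
      · exact h
    · exact h

lemma star_one {k : I} (a : Σ i, G i) : S.star ⟨k, 1⟩ a = a := by
  by_cases h : a.1 < k
  · rw [S.star_of_lt (b := ⟨k, 1⟩) h, S.one_act h a.2]
  · exact S.star_of_not_lt h

@[simp] lemma star_letterInv_star (b a : Σ i, G i) : S.star (letterInv b) (S.star b a) = a := by
  obtain ⟨k, b⟩ := b
  rw [letterInv, ← star_mul, mul_inv_cancel, star_one]

@[simp] lemma star_star_letterInv (b a : Σ i, G i) : S.star b (S.star (letterInv b) a) = a := by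
  simpa using S.star_letterInv_star (letterInv b) a

lemma star_fst_congr (b : Σ i, G i) {x y : Σ i, G i} (h : x.1 = y.1) :
    (S.star b x).1 = (S.star b y).1 := by
  obtain ⟨i, x⟩ := x
  obtain ⟨j, y⟩ := y
  obtain rfl : i = j := h
  by_cases h : i < b.1
  · rw [S.star_of_lt (a := ⟨i, x⟩) h, S.star_of_lt (a := ⟨i, y⟩) h]
  · rw [star_of_not_lt, star_of_not_lt]
    · exact h
    · exact h

lemma star_mk_mul (b : Σ i, G i) {j : I} (x y : G j) :
    ∃ (k : I) (x' y' : G k), S.star b ⟨j, x⟩ = ⟨k, x'⟩ ∧ S.star b ⟨j, y⟩ = ⟨k, y'⟩ ∧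
      S.star b ⟨j, x * y⟩ = ⟨k, x' * y'⟩ := by
  by_cases h : j < b.1
  · refine ⟨_, _, _, S.star_of_lt (a := ⟨j, x⟩) h, S.star_of_lt (a := ⟨j, y⟩) h, ?_⟩
    rw [S.star_of_lt (a := ⟨j, x * y⟩) h]
    simp
  · exact ⟨_, _, _, S.star_of_not_lt h, S.star_of_not_lt h, S.star_of_not_lt h⟩

lemma star_mk_one (b : Σ i, G i) (j : I) : (S.star b ⟨j, 1⟩).2 = 1 := by
  by_cases h : j < b.1
  · rw [S.star_of_lt (a := ⟨j, 1⟩) h]; simp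
  · rw [star_of_not_lt]
    exact h

lemma star_snd_eq_one {b a : Σ i, G i} : (S.star b a).2 = 1 ↔ a.2 = 1 := by
  constructor
  · intro h
    have h1 := S.star_letterInv_star b a
    have : S.star b a = ⟨(S.star b a).1, 1⟩ := by rw [← h]
    rw [this] at h1
    have h2 := S.star_mk_one (letterInv b) (S.star b a).1
    rw [h1] at h2
    exact h2
  · intro h
    have : a = ⟨a.1, 1⟩ := by rw [← h]
    rw [this]
    exact S.star_mk_one b a.1

lemma letterInv_star (b a : Σ i, G i) : letterInv (S.star b a) = S.star b (letterInv a) := by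
  by_cases h : a.1 < b.1
  · rw [S.star_of_lt h, S.star_of_lt (a := letterInv a) h]
    exact Sigma.ext rfl (heq_of_eq (map_inv _ _).symm)
  · rw [star_of_not_lt S h, star_of_not_lt]
    exact h

lemma star_lt_star {b x y : Σ i, G i} (hy : y.1 < b.1) (h : x.1 < y.1) :
    (S.star b x).1 < (S.star b y).1 := by
  rw [S.star_of_lt (h.trans hy), S.star_of_lt hy]
  exact S.obj_lt_obj _ _ _ h

lemma star_perp_star {b x y : Σ i, G i} (hx : x.1 < b.1) (hy : y.1 < b.1)
    (h : Oposet.Perp x.1 y.1) : Oposet.Perp (S.star b x).1 (S.star b y).1 := by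
  rw [S.star_of_lt hx, S.star_of_lt hy]
  exact S.obj_perp_obj _ _ _ h

/-- The quandle relation, for arbitrary indices below the index of `c`. -/
lemma star_star {a b c : Σ i, G i} (hac : a.1 < c.1) (hbc : b.1 < c.1) :
    S.star c (S.star b a) = S.star (S.star c b) (S.star c a) := by
  by_cases hab : a.1 < b.1
  · obtain ⟨i, a⟩ := a
    obtain ⟨j, b⟩ := b
    obtain ⟨k, c⟩ := c
    have h1 : S.star ⟨j, b⟩ ⟨i, a⟩ = ⟨_, _⟩ := S.star_of_lt hab
    have h2 : S.star ⟨k, c⟩ ⟨i, a⟩ = ⟨_, _⟩ := S.star_of_lt hac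
    have h3 : S.star ⟨k, c⟩ ⟨j, b⟩ = ⟨_, _⟩ := S.star_of_lt hbc
    rw [h1, h2, h3,
      S.star_of_lt (b := ⟨k, c⟩) (a := ⟨_, S.hom b hab a⟩) ((S.obj_lt b hab).trans hbc),
      S.star_of_lt (b := ⟨_, S.hom c hbc b⟩) (a := ⟨_, S.hom c hac a⟩)
        (S.obj_lt_obj c hac hbc hab)]
    exact S.quandle hab hbc a b c
  -- The inverse of `c` also preserves `<`, so acting by `c` cannot create a comparison between `a`
  -- and `b`; both sides reduce to `c ∗ a`.
  · rw [S.star_of_not_lt hab, S.star_of_not_lt (b := S.star c b)]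
    intro h
    have h1 : (S.star (letterInv c) (S.star c a)).1 < (S.star (letterInv c) (S.star c b)).1 :=
      S.star_lt_star (b := letterInv c) (S.star_lt hbc) h
    rw [star_letterInv_star, star_letterInv_star] at h1
    exact hab h1

/-- `Swap a b c d` says that `a * b = c * d` is one of the commutation relations of the quandle
product, where `a` and `d`, as well as `b` and `c`, are related by the action. -/
def Swap (a b c d : Σ i, G i) : Prop :=
  Linked a.1 b.1 ∧ c = S.star (letterInv a) b ∧ d = S.star b a

variable {S}

lemma swap_iff {a b c d : Σ i, G i} : S.Swap a b c d ↔
    (a.1 < b.1 ∧ c = b ∧ d = S.star b a) ∨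
    (b.1 < a.1 ∧ c = S.star (letterInv a) b ∧ d = a) ∨
    (Oposet.Perp a.1 b.1 ∧ c = b ∧ d = a) := by
  constructor
  · rintro ⟨h | h | h, rfl, rfl⟩
    · exact Or.inl ⟨h, S.star_of_not_lt h.not_gt, rfl⟩
    · exact Or.inr (Or.inl ⟨h, rfl, S.star_of_not_lt h.not_gt⟩)
    · exact Or.inr (Or.inr ⟨h, S.star_of_not_lt (not_gt_of_perp h),
        S.star_of_not_lt (not_lt_of_perp h)⟩)
  · rintro (⟨h, rfl, rfl⟩ | ⟨h, rfl, rfl⟩ | ⟨h, rfl, rfl⟩)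
    · exact ⟨Or.inl h, (S.star_of_not_lt (b := letterInv a) h.not_gt).symm, rfl⟩
    · exact ⟨Or.inr (Or.inl h), rfl, (S.star_of_not_lt h.not_gt).symm⟩
    · exact ⟨Or.inr (Or.inr h), (S.star_of_not_lt (b := letterInv d) (not_gt_of_perp h)).symm,
        (S.star_of_not_lt (not_lt_of_perp h)).symm⟩

lemma Swap.symm {a b c d : Σ i, G i} (h : S.Swap a b c d) : S.Swap c d a b := by
  rw [swap_iff] at h ⊢
  rcases h with ⟨h, rfl, rfl⟩ | ⟨h, rfl, rfl⟩ | ⟨h, rfl, rfl⟩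
  · exact Or.inr (Or.inl ⟨S.star_lt h, by simp, rfl⟩)
  · exact Or.inl ⟨S.star_lt (b := letterInv d) h, rfl, by simp⟩
  · exact Or.inr (Or.inr ⟨Oposet.perp_symm _ _ h, rfl, rfl⟩)

lemma Swap.unique {a b c d c' d' : Σ i, G i} (h : S.Swap a b c d) (h' : S.Swap a b c' d') :
    c = c' ∧ d = d' :=
  ⟨h.2.1.trans h'.2.1.symm, h.2.2.trans h'.2.2.symm⟩

lemma Swap.linked {a b c d : Σ i, G i} (h : S.Swap a b c d) : Linked a.1 c.1 := by
  rw [swap_iff] at h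
  rcases h with ⟨h, rfl, rfl⟩ | ⟨h, rfl, rfl⟩ | ⟨h, rfl, rfl⟩
  · exact Or.inl h
  · exact Or.inr (Or.inl (S.star_lt (b := letterInv d) h))
  · exact Or.inr (Or.inr h)

lemma Swap.linked' {a b c d : Σ i, G i} (h : S.Swap a b c d) : Linked d.1 b.1 := by
  rw [swap_iff] at h
  rcases h with ⟨h, rfl, rfl⟩ | ⟨h, rfl, rfl⟩ | ⟨h, rfl, rfl⟩
  · exact Or.inl (S.star_lt h)
  · exact Or.inr (Or.inl h)
  · exact Or.inr (Or.inr h)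

/-- If `a * b = c * d` is a commutation relation, so is `b * d⁻¹ = a⁻¹ * c`. -/
lemma Swap.rotate {a b c d : Σ i, G i} (h : S.Swap a b c d) :
    S.Swap b (letterInv d) (letterInv a) c := by
  rw [swap_iff] at h ⊢
  rcases h with ⟨h, rfl, rfl⟩ | ⟨h, rfl, rfl⟩ | ⟨h, rfl, rfl⟩
  · exact Or.inr (Or.inl ⟨S.star_lt h, by rw [letterInv_star, star_letterInv_star], rfl⟩)
  · exact Or.inl ⟨h, rfl, rfl⟩
  · exact Or.inr (Or.inr ⟨Oposet.perp_symm _ _ h, rfl, rfl⟩)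

lemma Swap.fst_congr {a b c d b' c' d' : Σ i, G i} (h : S.Swap a b c d) (h' : S.Swap a b' c' d')
    (e : c.1 = c'.1) : b.1 = b'.1 := by
  have h1 : b = S.star a c := by rw [h.2.1, star_star_letterInv]
  have h2 : b' = S.star a c' := by rw [h'.2.1, star_star_letterInv]
  rw [h1, h2]
  exact S.star_fst_congr a e

lemma Swap.fst_congr' {a b c d b' c' d' : Σ i, G i} (h : S.Swap a b c d) (h' : S.Swap a b' c' d')
    (e : b.1 = b'.1) : c.1 = c'.1 := by
  rw [h.2.1, h'.2.1]
  exact S.star_fst_congr _ e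

lemma Swap.snd_eq_one {a b c d : Σ i, G i} (h : S.Swap a b c d) : d.2 = 1 ↔ a.2 = 1 := by
  rw [h.2.2, star_snd_eq_one]

lemma Swap.snd_eq_one' {a b c d : Σ i, G i} (h : S.Swap a b c d) : c.2 = 1 ↔ b.2 = 1 := by
  rw [h.2.1, star_snd_eq_one]

lemma Swap.exists_of_fst_eq {a c d : Σ i, G i} {j : I} {x : G j} (h : S.Swap a ⟨j, x⟩ c d)
    (y : G j) : ∃ e f, S.Swap d ⟨j, y⟩ e f :=
  ⟨_, _, h.linked', rfl, rfl⟩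

/-- Passing `a` across two letters of the same index, one after the other, amounts to passing it
across their product. The point is that the second letter is conjugated by `d`, not by `a`: either
`d = a`, or both act trivially on index `j`. -/
lemma Swap.mul {a c d e f : Σ i, G i} {j : I} {x y : G j} (h : S.Swap a ⟨j, x⟩ c d)
    (h' : S.Swap d ⟨j, y⟩ e f) :
    ∃ (k : I) (x' y' : G k), c = ⟨k, x'⟩ ∧ e = ⟨k, y'⟩ ∧
      S.Swap a ⟨j, x * y⟩ ⟨k, x' * y'⟩ f := by
  have hf : f = S.star ⟨j, x * y⟩ a := by rw [star_mul, ← h.2.2, h'.2.2]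
  have he : e = S.star (letterInv a) ⟨j, y⟩ := by
    rcases h.1 with hl | hl | hl
    · have h1 : S.star (letterInv a) ⟨j, y⟩ = ⟨j, y⟩ := S.star_of_not_lt hl.not_gt
      have h2 : S.star (letterInv d) ⟨j, y⟩ = ⟨j, y⟩ := by
        rw [h.2.2]; exact S.star_of_not_lt (S.star_lt (b := ⟨j, x⟩) hl).not_gt
      rw [h'.2.1, h1, h2]
    · have : d = a := by rw [h.2.2]; exact S.star_of_not_lt hl.not_gt
      rw [h'.2.1, this]
    · have : d = a := by rw [h.2.2]; exact S.star_of_not_lt (not_lt_of_perp hl)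
      rw [h'.2.1, this]
  obtain ⟨k, x', y', h1, h2, h3⟩ := S.star_mk_mul (letterInv a) x y
  exact ⟨k, x', y', h.2.1.trans h1, he.trans h2, h.1, h3.symm, hf⟩

lemma Swap.of_lt {a b : Σ i, G i} (h : a.1 < b.1) : S.Swap a b b (S.star b a) :=
  swap_iff.2 (Or.inl ⟨h, rfl, rfl⟩)

lemma Swap.of_gt {a b c : Σ i, G i} (h : b.1 < a.1) (hc : c = S.star (letterInv a) b) :
    S.Swap a b c a :=
  swap_iff.2 (Or.inr (Or.inl ⟨h, hc, rfl⟩))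

lemma Swap.of_perp {a b : Σ i, G i} (h : Oposet.Perp a.1 b.1) : S.Swap a b b a :=
  swap_iff.2 (Or.inr (Or.inr ⟨h, rfl, rfl⟩))

lemma lt_of_star_lt_star {b x y : Σ i, G i} (hy : y.1 < b.1)
    (h : (S.star b x).1 < (S.star b y).1) : x.1 < y.1 := by
  have := S.star_lt_star (b := letterInv b) (y := S.star b y) (S.star_lt hy) h
  rwa [star_letterInv_star, star_letterInv_star] at this

lemma perp_of_star_perp_star {b x y : Σ i, G i} (hx : x.1 < b.1) (hy : y.1 < b.1)
    (h : Oposet.Perp (S.star b x).1 (S.star b y).1) : Oposet.Perp x.1 y.1 := by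
  have := S.star_perp_star (b := letterInv b) (x := S.star b x) (y := S.star b y)
    (S.star_lt hx) (S.star_lt hy) h
  rwa [star_letterInv_star, star_letterInv_star] at this

lemma perp_left {x y z : I} (h : x < y) (hp : Oposet.Perp y z) : Oposet.Perp x z :=
  Oposet.perp_of_le _ _ _ h.le hp

lemma perp_right {x y z : I} (h : x < y) (hp : Oposet.Perp z y) : Oposet.Perp z x :=
  Oposet.perp_symm _ _ (perp_left h (Oposet.perp_symm _ _ hp))

/-- The hexagon relation: if in the word `a b c` the letter `b` can be moved to the front of `a`,
and then `c` to the front of both, then `c` can be moved first. -/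
lemma Swap.hexagon {a b c a₁ b₁ c₁ a₂ b₂ c₂ : Σ i, G i} (h₁ : S.Swap a b b₁ a₁)
    (h₂ : S.Swap a₁ c c₁ a₂) (h₃ : S.Swap b₁ c₁ c₂ b₂) :
    ∃ a' b' c', S.Swap b c c' b' ∧ S.Swap a c' c₂ a' ∧ S.Swap a' b' b₂ a₂ := by
  -- Each of the three pairs is `<`, `>` or orthogonal. Of the 27 patterns, some contradict
  -- transitivity or the heredity of orthogonality; in the others the witnesses are forced.
  -- `star_star` is needed only where two of the letters lie below the third.
  rw [swap_iff] at h₁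
  rcases h₁ with ⟨hab, rfl, rfl⟩ | ⟨hab, rfl, rfl⟩ | ⟨hab, rfl, rfl⟩
  · have ha₁ : (S.star b₁ a).1 < b₁.1 := S.star_lt hab
    rw [swap_iff] at h₃
    rcases h₃ with ⟨hbc, rfl, rfl⟩ | ⟨hbc, rfl, rfl⟩ | ⟨hbc, rfl, rfl⟩
    · rcases swap_iff.1 h₂ with ⟨hac, rfl, rfl⟩ | ⟨hac, rfl, rfl⟩ | ⟨hac, rfl, rfl⟩
      · refine ⟨_, _, _, Swap.of_lt hbc, Swap.of_lt (hab.trans hbc), ?_⟩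
        rw [S.star_star (hab.trans hbc) hbc]
        exact Swap.of_lt (S.star_lt_star hbc hab)
      · exact absurd (((S.star_lt (b := letterInv (S.star b₁ a)) hac).trans ha₁).trans hbc)
          (lt_irrefl _)
      · exact absurd hac (not_perp_of_lt (ha₁.trans hbc))
    · rcases swap_iff.1 h₂ with ⟨hac, rfl, rfl⟩ | ⟨hac, rfl, rfl⟩ | ⟨hac, rfl, rfl⟩
      · have hac' : a.1 < (S.star (letterInv b₂) c₁).1 := by
          simpa using S.star_lt_star (b := letterInv b₂) hbc hac
        refine ⟨_, _, _, Swap.of_gt hbc rfl, Swap.of_lt hac', ?_⟩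
        have e := S.star_star hab (S.star_lt (b := letterInv b₂) hbc)
        rw [star_star_letterInv] at e
        rw [← e]
        exact Swap.of_lt ((S.star_lt hac').trans (S.star_lt (b := letterInv b₂) hbc))
      · have hcb : c.1 < b₂.1 := hac.trans ha₁
        have hac' : (S.star (letterInv b₂) c).1 < a.1 := by
          simpa using S.star_lt_star (b := letterInv b₂) ha₁ hac
        refine ⟨_, _, _, Swap.of_gt hcb rfl, Swap.of_gt hac' ?_, Swap.of_lt hab⟩
        rw [S.star_star (c := letterInv b₂) (b := letterInv _) hcb ha₁, ← letterInv_star,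
          star_letterInv_star]
      · have hac' : Oposet.Perp a.1 (S.star (letterInv b₂) c₁).1 := by
          simpa using S.star_perp_star (b := letterInv b₂) ha₁ hbc hac
        exact ⟨_, _, _, Swap.of_gt hbc rfl, Swap.of_perp hac', Swap.of_lt hab⟩
    · rcases swap_iff.1 h₂ with ⟨hac, rfl, rfl⟩ | ⟨hac, rfl, rfl⟩ | ⟨hac, rfl, rfl⟩
      · exact absurd (perp_left ha₁ hbc) (not_perp_of_lt hac)
      · exact absurd hbc
          (not_perp_of_gt ((S.star_lt (b := letterInv (S.star b₂ a)) hac).trans ha₁))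
      · exact ⟨_, _, _, Swap.of_perp hbc, Swap.of_perp (perp_left hab hbc), Swap.of_lt hab⟩
  · have hb₁ : (S.star (letterInv a₁) b).1 < a₁.1 := S.star_lt (b := letterInv a₁) hab
    rw [swap_iff] at h₃
    rcases h₃ with ⟨hbc, rfl, rfl⟩ | ⟨hbc, rfl, rfl⟩ | ⟨hbc, rfl, rfl⟩
    · rcases swap_iff.1 h₂ with ⟨hac, rfl, rfl⟩ | ⟨hac, rfl, rfl⟩ | ⟨hac, rfl, rfl⟩
      · refine ⟨_, _, _, Swap.of_lt (hab.trans hac), Swap.of_lt hac, ?_⟩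
        refine Swap.of_gt (S.star_lt_star hac hab) ?_
        rw [S.star_star (hab.trans hac) (b := letterInv _) hac, letterInv_star]
      · have hbc' : b.1 < c.1 := lt_of_star_lt_star (b := letterInv a₂) hac hbc
        refine ⟨_, _, _, Swap.of_lt hbc', Swap.of_gt hac rfl,
          Swap.of_gt ((S.star_lt hbc').trans hac) ?_⟩
        rw [S.star_star (c := letterInv _) hab hac]
      · exact absurd (perp_left hb₁ hac) (not_perp_of_lt hbc)
    · rcases swap_iff.1 h₂ with ⟨hac, rfl, rfl⟩ | ⟨hac, rfl, rfl⟩ | ⟨hac, rfl, rfl⟩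
      · exact absurd (hac.trans (hbc.trans hb₁)) (lt_irrefl _)
      · have hbc' : c.1 < b.1 := lt_of_star_lt_star (b := letterInv a₂) hab hbc
        refine ⟨_, _, _, Swap.of_gt hbc' rfl,
          Swap.of_gt ((S.star_lt (b := letterInv b) hbc').trans hab) ?_, Swap.of_gt hab rfl⟩
        rw [S.star_star (c := letterInv _) (b := letterInv _) hac hab, letterInv_star]
      · exact absurd hac (not_perp_of_gt (hbc.trans hb₁))
    · rcases swap_iff.1 h₂ with ⟨hac, rfl, rfl⟩ | ⟨hac, rfl, rfl⟩ | ⟨hac, rfl, rfl⟩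
      · exact absurd hbc (not_perp_of_lt (hb₁.trans hac))
      · exact ⟨_, _, _, Swap.of_perp (perp_of_star_perp_star (b := letterInv a₂) hab hac hbc),
          Swap.of_gt hac rfl, Swap.of_gt hab rfl⟩
      · exact ⟨_, _, _, Swap.of_perp (perp_left hab hac), Swap.of_perp hac, Swap.of_gt hab rfl⟩
  · rw [swap_iff] at h₃
    rcases h₃ with ⟨hbc, rfl, rfl⟩ | ⟨hbc, rfl, rfl⟩ | ⟨hbc, rfl, rfl⟩
    · rcases swap_iff.1 h₂ with ⟨hac, rfl, rfl⟩ | ⟨hac, rfl, rfl⟩ | ⟨hac, rfl, rfl⟩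
      · exact ⟨_, _, _, Swap.of_lt hbc, Swap.of_lt hac,
          Swap.of_perp (S.star_perp_star hac hbc hab)⟩
      · exact absurd hab (not_perp_of_gt (hbc.trans (S.star_lt (b := letterInv _) hac)))
      · exact ⟨_, _, _, Swap.of_lt hbc, Swap.of_perp hac,
          Swap.of_perp (perp_right (S.star_lt hbc) hac)⟩
    · rcases swap_iff.1 h₂ with ⟨hac, rfl, rfl⟩ | ⟨hac, rfl, rfl⟩ | ⟨hac, rfl, rfl⟩
      · exact absurd hab (not_perp_of_lt (hac.trans hbc))
      · exact absurd (perp_left (S.star_lt (b := letterInv _) hac) hab) (not_perp_of_lt hbc)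
      · exact ⟨_, _, _, Swap.of_gt hbc rfl,
          Swap.of_perp (perp_right (S.star_lt (b := letterInv _) hbc) hab), Swap.of_perp hab⟩
    · rcases swap_iff.1 h₂ with ⟨hac, rfl, rfl⟩ | ⟨hac, rfl, rfl⟩ | ⟨hac, rfl, rfl⟩
      · exact ⟨_, _, _, Swap.of_perp hbc, Swap.of_lt hac,
          Swap.of_perp (perp_left (S.star_lt hac) (Oposet.perp_symm _ _ hbc))⟩
      · exact ⟨_, _, _, Swap.of_perp (perp_right hac (Oposet.perp_symm _ _ hab)),
          Swap.of_gt hac rfl, Swap.of_perp hab⟩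
      · exact ⟨_, _, _, Swap.of_perp hbc, Swap.of_perp hac, Swap.of_perp hab⟩

end QuandleSystem

/-! ### Words up to exchanges, and reduced words. -/

namespace QuandleSystem

variable {I : Type u} [Oposet I] {G : I → Type v} [∀ i, Group (G i)]
variable (S : QuandleSystem I G)

/-- Two words are equivalent when they differ by a sequence of commutations of letters. -/
inductive WordEquiv : List (Σ i, G i) → List (Σ i, G i) → Prop
  | nil : WordEquiv [] []
  | cons (a : Σ i, G i) {u v : List (Σ i, G i)} : WordEquiv u v → WordEquiv (a :: u) (a :: v)
  | swap {a b c d : Σ i, G i} {u v t : List (Σ i, G i)} : S.Swap a b c d →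
      WordEquiv u (b :: t) → WordEquiv v (d :: t) → WordEquiv (a :: u) (c :: v)

variable {S}

namespace WordEquiv

lemma length_eq {u v : List (Σ i, G i)} (h : S.WordEquiv u v) : u.length = v.length := by
  induction h with
  | nil => rfl
  | cons a _ ih => simp [ih]
  | swap _ _ _ ih₁ ih₂ => simp_all

lemma refl (u : List (Σ i, G i)) : S.WordEquiv u u := by
  induction u with
  | nil => exact .nil
  | cons a u ih => exact .cons a ih

lemma symm {u v : List (Σ i, G i)} (h : S.WordEquiv u v) : S.WordEquiv v u := by
  induction h with
  | nil => exact .nil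
  | cons a _ ih => exact .cons a ih
  | swap h h₁ h₂ _ _ => exact .swap h.symm h₂ h₁

lemma cons_cons {a b : Σ i, G i} {u v : List (Σ i, G i)} (h : S.WordEquiv (a :: u) (b :: v)) :
    (a = b ∧ S.WordEquiv u v) ∨
      ∃ a' b' t, S.Swap a b' b a' ∧ S.WordEquiv u (b' :: t) ∧ S.WordEquiv v (a' :: t) := by
  cases h with
  | cons _ h => exact Or.inl ⟨rfl, h⟩
  | swap h h₁ h₂ => exact Or.inr ⟨_, _, _, h, h₁, h₂⟩

/-- The recursive form of `WordEquiv` makes inversion on front letters immediate (`cons_cons`), and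
the cost is transitivity. The induction is on the length of the middle word; when the front letter
changes twice, the two swaps either cancel or are rearranged by the hexagon relation. -/
lemma trans_aux (n : ℕ) : ∀ {u v w : List (Σ i, G i)}, v.length = n → S.WordEquiv u v →
    S.WordEquiv v w → S.WordEquiv u w := by
  induction n with
  | zero =>
    intro u v w hv h h'
    obtain rfl := List.eq_nil_of_length_eq_zero hv
    cases h; cases h'; exact .nil
  | succ n ih =>
    intro x y z hv h h'
    match y, hv with
    | b :: v, hv =>
    match x, h.length_eq with
    | a :: u, hu =>
    match z, h'.length_eq with
    | c :: w, hw =>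
    simp only [List.length_cons, add_left_inj] at hv hu hw
    rcases h.cons_cons with ⟨rfl, h₁⟩ | ⟨a₁, b₁, t, hs, h₁, h₂⟩
    · rcases h'.cons_cons with ⟨rfl, h₃⟩ | ⟨b₂, c₁, s, hs', h₃, h₄⟩
      · exact .cons _ (ih hv h₁ h₃)
      · exact .swap hs' (ih hv h₁ h₃) h₄
    · rcases h'.cons_cons with ⟨rfl, h₃⟩ | ⟨b₂, c₁, s, hs', h₃, h₄⟩
      · exact .swap hs h₁ (ih hv h₃.symm h₂)
      · have h₅ : S.WordEquiv (a₁ :: t) (c₁ :: s) := ih hv h₂.symm h₃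
        have ht : t.length + 1 = n := by rw [← hv]; exact h₂.length_eq.symm
        have hsl : s.length + 1 = n := by rw [← hv]; exact h₃.length_eq.symm
        -- Both `a₁ :: t` and `c₁ :: s` are equivalent to the tail `v` of the middle word. If `a₁ =
        -- c₁`, the second swap undoes the first one.
        rcases h₅.cons_cons with ⟨rfl, h₆⟩ | ⟨a₂, c₂, r, hs'', h₆, h₇⟩
        · obtain ⟨rfl, rfl⟩ := hs.symm.unique hs'
          exact .cons _ (ih (by simpa using ht) h₁ (ih (by simpa using hsl) (.cons _ h₆) h₄.symm))
        · obtain ⟨a₃, b₃, c₃, e₁, e₂, e₃⟩ := hs.hexagon hs'' hs'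
          have hr : t.length = r.length + 1 := h₆.length_eq
          refine .swap e₂ (t := b₃ :: r) ?_ ?_
          · exact ih (by simpa using ht) h₁ (.swap e₁ h₆ (.refl _))
          · exact ih (by simpa using hsl) h₄ (.swap e₃.symm h₇ (.refl _))

lemma trans {u v w : List (Σ i, G i)} (h : S.WordEquiv u v) (h' : S.WordEquiv v w) :
    S.WordEquiv u w := trans_aux _ rfl h h'

lemma of_swap {a b c d : Σ i, G i} (h : S.Swap a b c d) (t : List (Σ i, G i)) :
    S.WordEquiv (a :: b :: t) (c :: d :: t) := .swap h (.refl _) (.refl _)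

end WordEquiv

variable (S)

/-- The word `w` is equivalent to a word that begins with a letter of index `k`. -/
def HasFront (k : I) (w : List (Σ i, G i)) : Prop :=
  ∃ a v, S.WordEquiv w (a :: v) ∧ a.1 = k

/-- A word is reduced when its letters are non-trivial and no two letters can be merged. -/
def Reduced : List (Σ i, G i) → Prop
  | [] => True
  | a :: w => a.2 ≠ 1 ∧ ¬ S.HasFront a.1 w ∧ Reduced w

variable {S}

lemma reduced_nil : S.Reduced [] := trivial

lemma reduced_cons {a : Σ i, G i} {w : List (Σ i, G i)} :
    S.Reduced (a :: w) ↔ a.2 ≠ 1 ∧ ¬ S.HasFront a.1 w ∧ S.Reduced w := Iff.rfl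

lemma HasFront.congr {k : I} {v w : List (Σ i, G i)} (h : S.WordEquiv v w) :
    S.HasFront k v ↔ S.HasFront k w :=
  ⟨fun ⟨a, t, e, ha⟩ => ⟨a, t, h.symm.trans e, ha⟩, fun ⟨a, t, e, ha⟩ => ⟨a, t, h.trans e, ha⟩⟩

lemma not_hasFront_nil (k : I) : ¬ S.HasFront k [] := by
  rintro ⟨a, v, h, _⟩
  cases h

/-- A letter that can be moved past `b` has, before and after, indices that depend only on each
other. -/
lemma HasFront.of_swap {a b c d : Σ i, G i} (h : S.Swap a b c d) {t : List (Σ i, G i)}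
    (ht : S.HasFront d.1 t) : S.HasFront a.1 (b :: t) := by
  obtain ⟨e, r, her, hed⟩ := ht
  have hl : Linked b.1 e.1 := by rw [hed]; exact h.linked'.symm
  obtain ⟨f, g, hs⟩ : ∃ f g, S.Swap b e f g := ⟨_, _, hl, rfl, rfl⟩
  refine ⟨f, g :: r, .swap hs her (.refl _), ?_⟩
  exact Swap.fst_congr' (b' := letterInv d) (c' := letterInv a) hs h.rotate hed

lemma Reduced.congr_aux (n : ℕ) : ∀ {u v : List (Σ i, G i)}, u.length = n → S.WordEquiv u v →
    S.Reduced u → S.Reduced v := by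
  induction n with
  | zero =>
    intro u v hu h _
    obtain rfl := List.eq_nil_of_length_eq_zero hu
    cases h; trivial
  | succ n ih =>
    intro x y hx h hr
    match x, hx with
    | a :: u, hu =>
    match y, h.length_eq with
    | b :: v, _ =>
    simp only [List.length_cons, add_left_inj] at hu
    obtain ⟨ha, hf, hru⟩ := hr
    rcases h.cons_cons with ⟨rfl, h₁⟩ | ⟨a', b', t, hs, h₁, h₂⟩
    · exact ⟨ha, fun h => hf ((HasFront.congr h₁).2 h), ih hu h₁ hru⟩
    · have hlen : u.length = t.length + 1 := h₁.length_eq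
      obtain ⟨hb', hfb, hrt⟩ := ih hu h₁ hru
      have hra : S.Reduced (a' :: t) := ⟨fun e => ha (hs.snd_eq_one.1 e),
        fun hfa => hf ((HasFront.congr h₁).2 (HasFront.of_swap hs hfa)), hrt⟩
      refine ⟨fun e => hb' (hs.snd_eq_one'.1 e), ?_,
        ih (by rw [List.length_cons, ← hlen, hu]) h₂.symm hra⟩
      -- A front letter of `a' :: t` with the index of `b` is not `a'`, because linked indices are
      -- distinct. So it was moved past `a'`, and starts in `t` with the index of `b'`, although `b'
      -- :: t` is reduced.
      rintro ⟨c, s, hcs, hcb⟩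
      rcases (h₂.symm.trans hcs).cons_cons with ⟨rfl, _⟩ | ⟨a'', c', r, hs', h₃, _⟩
      · exact hs.symm.1.ne hcb.symm
      · exact hfb ⟨c', r, h₃,
          hs'.fst_congr (b' := letterInv b') (c' := letterInv b) hs.symm.rotate hcb⟩

lemma Reduced.congr {u v : List (Σ i, G i)} (h : S.WordEquiv u v) (hu : S.Reduced u) :
    S.Reduced v := Reduced.congr_aux _ rfl h hu

/-- In a reduced word that begins with `b`, a letter with the index of `a` that can be moved to the
front comes from a letter that can be moved past `b`. -/
lemma hasFront_of_cons {a b c d : Σ i, G i} (h : S.Swap a b c d) {w : List (Σ i, G i)}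
    (hw : S.HasFront a.1 (b :: w)) : S.HasFront d.1 w := by
  obtain ⟨e, v, hev, hea⟩ := hw
  rcases hev.cons_cons with ⟨rfl, _⟩ | ⟨_, e', t, hs, h₁, _⟩
  · exact absurd hea.symm h.1.ne
  · exact ⟨e', t, h₁, hs.fst_congr (b' := letterInv d) (c' := letterInv a) h.rotate hea⟩

/-! ### Normal forms and the action of the quandle product on them. -/

variable (S)

/-- Equivalence of reduced words. -/
def reducedSetoid : Setoid {w : List (Σ i, G i) // S.Reduced w} where
  r u v := S.WordEquiv u.1 v.1
  iseqv := ⟨fun u => .refl u.1, fun h => h.symm, fun h h' => h.trans h'⟩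

/-- Normal forms: reduced words up to equivalence. -/
def NormalForm : Type (max u v) := Quotient S.reducedSetoid

variable {S}

namespace NormalForm

/-- The normal form of a reduced word. -/
def mk (w : List (Σ i, G i)) (h : S.Reduced w) : S.NormalForm :=
  Quotient.mk S.reducedSetoid ⟨w, h⟩

lemma mk_eq_mk {v w : List (Σ i, G i)} {hv : S.Reduced v} {hw : S.Reduced w} :
    mk v hv = mk w hw ↔ S.WordEquiv v w := by
  unfold mk
  exact Quotient.eq (r := S.reducedSetoid)

lemma exists_mk (q : S.NormalForm) : ∃ w h, q = mk w h := by
  induction q using Quotient.inductionOn with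
  | h w => exact ⟨w.1, w.2, rfl⟩

/-- No letter of index `k` can be moved to the front. -/
def NoFront (k : I) (q : S.NormalForm) : Prop := ∀ w h, q = mk w h → ¬ S.HasFront k w

lemma noFront_mk {k : I} {w : List (Σ i, G i)} {h : S.Reduced w} :
    NoFront k (mk w h) ↔ ¬ S.HasFront k w :=
  ⟨fun H => H w h rfl, fun H _ _ e hf => H ((HasFront.congr (mk_eq_mk.1 e)).2 hf)⟩

open Classical in
/-- Adding a letter of index `k` to a normal form without front letter of index `k`. -/
noncomputable def cons (k : I) (p : G k × {q : S.NormalForm // q.NoFront k}) : S.NormalForm :=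
  if h : p.1 = 1 then p.2.1
  else mk (⟨k, p.1⟩ :: p.2.1.exists_mk.choose) (reduced_cons.2 ⟨h,
    p.2.2 _ _ p.2.1.exists_mk.choose_spec.choose_spec, p.2.1.exists_mk.choose_spec.choose⟩)

lemma cons_one (k : I) (q : {q : S.NormalForm // q.NoFront k}) : cons k (1, q) = q.1 :=
  dif_pos rfl

lemma cons_mk {k : I} {x : G k} (hx : x ≠ 1) {w : List (Σ i, G i)} (hw : S.Reduced w)
    (hf : ¬ S.HasFront k w) :
    cons k (x, ⟨mk w hw, noFront_mk.2 hf⟩) = mk (⟨k, x⟩ :: w) (reduced_cons.2 ⟨hx, hf, hw⟩) := by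
  rw [cons, dif_neg hx]
  exact mk_eq_mk.2 (.cons _ (mk_eq_mk.1 (mk w hw).exists_mk.choose_spec.choose_spec.symm))

/-- A front letter of index `k` is unique: front letters of equivalent words are equal or have
linked, hence distinct, indices. -/
lemma cons_injective (k : I) : Function.Injective (cons (S := S) k) := by
  rintro ⟨x, q, hq⟩ ⟨y, r, hr⟩ e
  obtain ⟨v, hv, rfl⟩ := q.exists_mk
  obtain ⟨w, hw, rfl⟩ := r.exists_mk
  have hq' := noFront_mk.1 hq
  have hr' := noFront_mk.1 hr
  by_cases hx : x = 1
  · subst hx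
    by_cases hy : y = 1
    · subst hy
      simpa [cons_one] using e
    · rw [cons_one, cons_mk hy hw hr'] at e
      exact absurd ⟨_, _, mk_eq_mk.1 e, rfl⟩ hq'
  · by_cases hy : y = 1
    · subst hy
      rw [cons_one, cons_mk hx hv hq'] at e
      exact absurd ⟨_, _, (mk_eq_mk.1 e).symm, rfl⟩ hr'
    · rw [cons_mk hx hv hq', cons_mk hy hw hr', mk_eq_mk] at e
      rcases e.cons_cons with ⟨e₁, e₂⟩ | ⟨_, _, _, hs, _⟩
      · obtain rfl : x = y := by simpa using e₁
        obtain h := mk_eq_mk (hv := hv) (hw := hw) |>.2 e₂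
        simp [h]
      · exact absurd rfl hs.linked.ne

lemma cons_surjective (k : I) : Function.Surjective (cons (S := S) k) := by
  intro q
  obtain ⟨w, hw, rfl⟩ := q.exists_mk
  by_cases hf : S.HasFront k w
  · obtain ⟨a, v, h, rfl⟩ := hf
    obtain ⟨h₁, h₂, h₃⟩ := hw.congr h
    exact ⟨_, (cons_mk h₁ h₃ h₂).trans (mk_eq_mk.2 h.symm)⟩
  · exact ⟨_, cons_one k ⟨_, noFront_mk.2 hf⟩⟩

/-- The decomposition of normal forms into a front letter of index `k`, possibly trivial, and
a rest. -/
noncomputable def consEquiv (k : I) : G k × {q : S.NormalForm // q.NoFront k} ≃ S.NormalForm :=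
  Equiv.ofBijective (cons k) ⟨cons_injective k, cons_surjective k⟩

/-- The action of the factor `G k` on normal forms. -/
noncomputable def perm (k : I) : G k →* Equiv.Perm S.NormalForm where
  toFun x := (consEquiv k).symm.trans
    (((Equiv.mulLeft x).prodCongr (Equiv.refl _)).trans (consEquiv k))
  map_one' := by ext q; simp
  map_mul' x y := by ext q; simp [Prod.map_map, Function.comp_def]

lemma perm_cons {k : I} (x y : G k) (q : {q : S.NormalForm // q.NoFront k}) :
    perm k x (cons k (y, q)) = cons k (x * y, q) := by
  have h : (consEquiv k).symm (cons k (y, q)) = (y, q) := (consEquiv k).symm_apply_apply (y, q)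
  change consEquiv k (((Equiv.mulLeft x).prodCongr (Equiv.refl _)) ((consEquiv k).symm _)) = _
  rw [h]
  rfl

lemma perm_mk {a : Σ i, G i} {w : List (Σ i, G i)} (h : S.Reduced (a :: w)) :
    perm a.1 a.2 (mk w h.2.2) = mk (a :: w) h := by
  have := perm_cons a.2 1 ⟨mk w h.2.2, noFront_mk.2 h.2.1⟩
  rw [cons_one, mul_one] at this
  exact this.trans (cons_mk h.1 h.2.2 h.2.1)

/-- Here `b` merges with the first letter of `w`, so `a :: b :: w` is not reduced. Splitting off
that letter reduces the relation to two exchanges acting on the shorter word `v`. -/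
lemma perm_swap_of_hasFront {a b c d : Σ i, G i} (h : S.Swap a b c d) {w : List (Σ i, G i)}
    (hw : S.Reduced w) (hf : S.HasFront b.1 w)
    (ih : ∀ (v : List (Σ i, G i)) (hv : S.Reduced v) {a b c d : Σ i, G i}, v.length < w.length →
      S.Swap a b c d →
      perm a.1 a.2 (perm b.1 b.2 (mk v hv)) = perm c.1 c.2 (perm d.1 d.2 (mk v hv))) :
    perm a.1 a.2 (perm b.1 b.2 (mk w hw)) = perm c.1 c.2 (perm d.1 d.2 (mk w hw)) := by
  obtain ⟨⟨j, y⟩, v, hv, e⟩ := hf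
  obtain ⟨i, x⟩ := b
  obtain rfl : j = i := e
  have hr := hw.congr hv
  have hl : v.length < w.length := by rw [hv.length_eq]; simp
  rw [show mk w hw = mk _ hr from mk_eq_mk.2 hv, ← perm_mk hr]
  -- With `b = x` and `w = y v`: `a (x y) v = (x' y') f v = x' (d y v) = c d w`.
  obtain ⟨e, f, h'⟩ := h.exists_of_fst_eq y
  obtain ⟨k, x', y', rfl, rfl, hm⟩ := h.mul h'
  have h₁ := ih v hr.2.2 hl h'
  have h₂ := ih v hr.2.2 hl hm
  simp only [map_mul, Equiv.Perm.mul_apply] at h₁ h₂ ⊢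
  rw [h₁, h₂]

/-- Unless some letter is trivial or merges with `w`, the words `a :: b :: w` and `c :: d :: w` are
both reduced, and equivalent by one swap. `b` can merge with `w` directly, `a` only after becoming
`d`. -/
lemma perm_swap_aux (n : ℕ) : ∀ (w : List (Σ i, G i)) (hw : S.Reduced w) {a b c d : Σ i, G i},
    w.length = n → S.Swap a b c d →
      perm a.1 a.2 (perm b.1 b.2 (mk w hw)) = perm c.1 c.2 (perm d.1 d.2 (mk w hw)) := by
  induction n using Nat.strong_induction_on with
  | _ n ih =>
    intro w hw a b c d hn h
    subst hn
    by_cases hb : S.HasFront b.1 w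
    · exact perm_swap_of_hasFront h hw hb fun v hv _ _ _ _ hl h => ih _ hl v hv rfl h
    by_cases hd : S.HasFront d.1 w
    · exact (perm_swap_of_hasFront h.symm hw hd fun v hv _ _ _ _ hl h => ih _ hl v hv rfl h).symm
    by_cases ha : a.2 = 1
    · have hd1 : d.2 = 1 := h.snd_eq_one.2 ha
      have hcb : c = b := by
        rw [h.2.1]
        have : letterInv a = ⟨a.1, 1⟩ := by simp [letterInv, ha]
        rw [this, star_one]
      rw [ha, hd1, hcb]; simp
    by_cases hb1 : b.2 = 1
    · have hc1 : c.2 = 1 := h.snd_eq_one'.2 hb1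
      have hda : d = a := by
        rw [h.2.2]
        have : b = ⟨b.1, 1⟩ := by rw [← hb1]
        rw [this, star_one]
      rw [hb1, hc1, hda]; simp
    have key : ∀ {a b c d : Σ i, G i} (_ : S.Swap a b c d), a.2 ≠ 1 → b.2 ≠ 1 →
        ¬ S.HasFront b.1 w → ¬ S.HasFront d.1 w → ∃ hr : S.Reduced (a :: b :: w),
        perm a.1 a.2 (perm b.1 b.2 (mk w hw)) = mk _ hr := by
      intro a b c d h ha hb hfb hfd
      have hr : S.Reduced (a :: b :: w) := ⟨ha, fun hf => hfd (hasFront_of_cons h hf), hb, hfb, hw⟩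
      exact ⟨hr, by rw [perm_mk hr.2.2, perm_mk hr]⟩
    obtain ⟨_, e₁⟩ := key h ha hb1 hb hd
    obtain ⟨_, e₂⟩ := key h.symm (fun e => hb1 (h.snd_eq_one'.1 e))
      (fun e => ha (h.snd_eq_one.1 e)) hd hb
    rw [e₁, e₂]
    exact mk_eq_mk.2 (.of_swap h w)

lemma perm_swap {a b c d : Σ i, G i} (h : S.Swap a b c d) :
    perm (S := S) a.1 a.2 * perm b.1 b.2 = perm c.1 c.2 * perm d.1 d.2 := by
  ext q
  obtain ⟨w, hw, rfl⟩ := q.exists_mk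
  exact perm_swap_aux _ w hw rfl h

variable (S)

/-- The action of the quandle product on normal forms. -/
noncomputable def permHom : S.Product →* Equiv.Perm S.NormalForm :=
  QuotientGroup.lift (Subgroup.normalClosure S.relators) (Monoid.CoprodI.lift perm) (by
    change Subgroup.normalClosure S.relators ≤ (Monoid.CoprodI.lift perm).ker
    refine Subgroup.normalClosure_le_normal ?_
    rintro r (⟨i, j, h, a, b, rfl⟩ | ⟨i, j, h, a, b, rfl⟩)
    · have := perm_swap (Swap.of_perp (S := S) (a := ⟨i, a⟩) (b := ⟨j, b⟩) h)
      rw [SetLike.mem_coe, MonoidHom.mem_ker, map_mul, map_inv, mul_inv_eq_one]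
      simpa using this
    · have := perm_swap (Swap.of_lt (S := S) (a := ⟨i, a⟩) (b := ⟨j, b⟩) h)
      rw [star_of_lt S (b := ⟨j, b⟩) (a := ⟨i, a⟩) h] at this
      rw [SetLike.mem_coe, MonoidHom.mem_ker, map_mul, map_inv, mul_inv_eq_one]
      simpa using this)

lemma permHom_of (i : I) (x : G i) : permHom S (S.of i x) = perm i x := by
  simp [permHom, QuandleSystem.of]

end NormalForm

/-! ### Elements represented by words. -/

variable (S)

/-- The element of the quandle product represented by a word. -/
def wordProd (w : List (Σ i, G i)) : S.Product := (w.map fun a => S.of a.1 a.2).prod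

@[simp] lemma wordProd_nil : S.wordProd [] = 1 := rfl

@[simp] lemma wordProd_cons (a : Σ i, G i) (w : List (Σ i, G i)) :
    S.wordProd (a :: w) = S.of a.1 a.2 * S.wordProd w := by simp [wordProd]

variable {S}

lemma Swap.of_mul_of {a b c d : Σ i, G i} (h : S.Swap a b c d) :
    S.of a.1 a.2 * S.of b.1 b.2 = S.of c.1 c.2 * S.of d.1 d.2 := by
  have hlt : ∀ {a b : Σ i, G i}, a.1 < b.1 → S.of a.1 a.2 * S.of b.1 b.2 =
      S.of b.1 b.2 * S.of (S.star b a).1 (S.star b a).2 := by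
    intro a b h
    rw [star_of_lt S h, ← mul_inv_eq_one]
    exact (QuotientGroup.eq_one_iff _).2
      (Subgroup.subset_normalClosure (Or.inr ⟨a.1, b.1, h, a.2, b.2, rfl⟩))
  rcases swap_iff.1 h with ⟨hl, rfl, rfl⟩ | ⟨hl, rfl, rfl⟩ | ⟨hl, rfl, rfl⟩
  · exact hlt hl
  · have := hlt (b := d) (S.star_lt (b := letterInv d) hl)
    rw [star_star_letterInv] at this
    exact this.symm
  · rw [← mul_inv_eq_one]
    exact (QuotientGroup.eq_one_iff _).2
      (Subgroup.subset_normalClosure (Or.inl ⟨_, _, hl, d.2, c.2, rfl⟩))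

lemma WordEquiv.wordProd_eq {u v : List (Σ i, G i)} (h : S.WordEquiv u v) :
    S.wordProd u = S.wordProd v := by
  induction h with
  | nil => rfl
  | cons a _ ih => simp [ih]
  | swap h _ _ ih₁ ih₂ => simp only [wordProd_cons, ih₁, ih₂, ← mul_assoc, h.of_mul_of]

end QuandleSystem

/-! ### Weakly modular graphs. -/

namespace QuasiMedian

/-- Metric conditions that characterize quasi-median graphs: the triangle and quadrangle
conditions, and the absence of `K₄⁻` and `K₂,₃` as induced subgraphs. -/
structure IsWeaklyModular {V : Type u} (X : SimpleGraph V) : Prop where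
  connected : X.Connected
  triangle : ∀ u v w, X.Adj v w → X.dist u v = X.dist u w →
    ∃ x, X.Adj x v ∧ X.Adj x w ∧ X.dist u x + 1 = X.dist u v
  quadrangle : ∀ u z v w, X.Adj z v → X.Adj z w → v ≠ w → X.dist u v + 1 = X.dist u z →
    X.dist u w + 1 = X.dist u z → ∃ x, X.Adj x v ∧ X.Adj x w ∧ X.dist u x + 1 = X.dist u v
  no_K4_minus : ∀ a b c d, X.Adj a b → X.Adj a c → X.Adj a d → X.Adj b c → X.Adj b d → c ≠ d →
    X.Adj c d
  no_K23 : ∀ u z v₁ v₂ v₃, X.dist u z = 2 → X.Adj u v₁ → X.Adj u v₂ → X.Adj u v₃ →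
    X.Adj v₁ z → X.Adj v₂ z → X.Adj v₃ z → v₁ = v₂ ∨ v₁ = v₃ ∨ v₂ = v₃

end QuasiMedian

/-! ### The word problem, and the local geometry of the Cayley graph. -/

namespace QuandleSystem

variable {I : Type u} [Oposet I] {G : I → Type v} [∀ i, Group (G i)]
variable (S : QuandleSystem I G)

lemma exists_wordProd_eq (x : S.Product) : ∃ w, S.wordProd w = x := by
  induction x using QuotientGroup.induction_on with
  | H x =>
    induction x using Monoid.CoprodI.induction_on with
    | one => exact ⟨[], rfl⟩
    | of i a => exact ⟨[⟨i, a⟩], by rw [wordProd_cons, wordProd_nil, mul_one]; rfl⟩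
    | mul x y hx hy =>
      obtain ⟨u, hu⟩ := hx
      obtain ⟨v, hv⟩ := hy
      exact ⟨u ++ v, by
        rw [QuotientGroup.mk_mul, ← hu, ← hv]; simp [wordProd]⟩

namespace NormalForm

variable {S}

/-- The element of the quandle product with a given normal form. -/
def val (q : S.NormalForm) : S.Product :=
  Quotient.liftOn q (fun w => S.wordProd w.1) fun _ _ h => WordEquiv.wordProd_eq h

lemma val_mk {w : List (Σ i, G i)} (h : S.Reduced w) : (mk w h).val = S.wordProd w := rfl

lemma val_cons (k : I) (x : G k) (q : {q : S.NormalForm // q.NoFront k}) :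
    (cons k (x, q)).val = S.of k x * q.1.val := by
  obtain ⟨q, hq⟩ := q
  obtain ⟨w, hw, rfl⟩ := q.exists_mk
  by_cases hx : x = 1
  · subst hx; simp [cons_one]
  · rw [cons_mk hx hw (noFront_mk.1 hq), val_mk, wordProd_cons, val_mk]

lemma val_perm (k : I) (x : G k) (q : S.NormalForm) : (perm k x q).val = S.of k x * q.val := by
  obtain ⟨⟨y, q⟩, rfl⟩ := cons_surjective k q
  rw [perm_cons, val_cons, val_cons, map_mul, mul_assoc]

lemma val_permHom (x : S.Product) (q : S.NormalForm) : (permHom S x q).val = x * q.val := by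
  obtain ⟨w, rfl⟩ := S.exists_wordProd_eq x
  induction w with
  | nil => simp
  | cons a w ih => rw [wordProd_cons, map_mul, Equiv.Perm.mul_apply, permHom_of, val_perm, ih,
      mul_assoc]

/-- Applied to the empty normal form, an element returns the class of any of its reduced words, so
that class depends only on the element. -/
lemma permHom_wordProd {w : List (Σ i, G i)} (h : S.Reduced w) :
    permHom S (S.wordProd w) (mk [] reduced_nil) = mk w h := by
  induction w with
  | nil => simp
  | cons a w ih => rw [wordProd_cons, map_mul, Equiv.Perm.mul_apply, permHom_of, ih h.2.2, perm_mk h]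

end NormalForm

lemma exists_reduced (x : S.Product) : ∃ w, S.Reduced w ∧ S.wordProd w = x := by
  obtain ⟨w, hw, e⟩ := (NormalForm.permHom S x (NormalForm.mk [] reduced_nil)).exists_mk
  refine ⟨w, hw, ?_⟩
  rw [← NormalForm.val_mk hw, ← e, NormalForm.val_permHom, NormalForm.val_mk, wordProd_nil, mul_one]

variable {S}

/-- Solution of the word problem: reduced words are unique up to commutations. -/
lemma Reduced.wordEquiv {u v : List (Σ i, G i)} (hu : S.Reduced u) (hv : S.Reduced v)
    (h : S.wordProd u = S.wordProd v) : S.WordEquiv u v := by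
  rw [← NormalForm.mk_eq_mk (hv := hu) (hw := hv), ← NormalForm.permHom_wordProd hu, h,
    NormalForm.permHom_wordProd hv]

/-- The length of an element: the number of letters of its reduced words. -/
noncomputable def len (x : S.Product) : ℕ := (S.exists_reduced x).choose.length

lemma len_wordProd {w : List (Σ i, G i)} (h : S.Reduced w) : len (S.wordProd w) = w.length := by
  have := (S.exists_reduced (S.wordProd w)).choose_spec
  exact (this.1.wordEquiv h this.2).length_eq

lemma len_one : len (1 : S.Product) = 0 := len_wordProd (S := S) (w := []) trivial

lemma len_eq_zero {x : S.Product} : len x = 0 ↔ x = 1 := by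
  constructor
  · intro h
    obtain ⟨w, hw, rfl⟩ := S.exists_reduced x
    rw [len_wordProd hw] at h
    rw [List.eq_nil_of_length_eq_zero h, wordProd_nil]
  · rintro rfl; exact len_one

lemma reduced_singleton {k : I} {c : G k} (hc : c ≠ 1) : S.Reduced [⟨k, c⟩] :=
  ⟨hc, not_hasFront_nil _, trivial⟩

lemma len_of {k : I} {c : G k} (hc : c ≠ 1) : len (S.of k c) = 1 := by
  simpa using len_wordProd (reduced_singleton (S := S) hc)

lemma of_ne_one {k : I} {c : G k} (hc : c ≠ 1) : S.of k c ≠ 1 := by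
  rw [Ne, ← len_eq_zero, len_of hc]; simp

lemma of_mul_cases {k : I} {c : G k} (hc : c ≠ 1) (x : S.Product) :
    len (S.of k c * x) = len x + 1 ∨ ∃ (b : G k) (v : List (Σ i, G i)),
      S.Reduced (⟨k, b⟩ :: v) ∧ S.wordProd (⟨k, b⟩ :: v) = x := by
  obtain ⟨w, hw, rfl⟩ := S.exists_reduced x
  by_cases hf : S.HasFront k w
  · obtain ⟨⟨_, b⟩, v, h, rfl⟩ := hf
    exact Or.inr ⟨b, v, hw.congr h, h.wordProd_eq.symm⟩
  · left
    have hr : S.Reduced (⟨k, c⟩ :: w) := ⟨hc, hf, hw⟩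
    rw [len_wordProd hw, ← S.wordProd_cons ⟨k, c⟩ w, len_wordProd hr, List.length_cons]

lemma len_of_mul_front {k : I} {b : G k} {v : List (Σ i, G i)} (h : S.Reduced (⟨k, b⟩ :: v))
    {c : G k} (hc : c * b ≠ 1) :
    len (S.of k c * S.wordProd (⟨k, b⟩ :: v)) = len (S.wordProd (⟨k, b⟩ :: v)) := by
  have hr : S.Reduced (⟨k, c * b⟩ :: v) := ⟨hc, h.2⟩
  have e : S.of k c * S.wordProd (⟨k, b⟩ :: v) = S.wordProd (⟨k, c * b⟩ :: v) := by
    rw [wordProd_cons, wordProd_cons, map_mul, mul_assoc]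
  rw [e, len_wordProd hr, len_wordProd h]
  simp

lemma inv_of_mul_wordProd {k : I} (b : G k) (v : List (Σ i, G i)) :
    S.of k b⁻¹ * S.wordProd (⟨k, b⟩ :: v) = S.wordProd v := by
  rw [wordProd_cons, map_inv, inv_mul_cancel_left]

lemma len_of_mul_le (k : I) (c : G k) (x : S.Product) : len (S.of k c * x) ≤ len x + 1 := by
  by_cases hc : c = 1
  · simp [hc]
  rcases of_mul_cases hc x with h | ⟨b, v, h, rfl⟩
  · exact h.le
  · by_cases hb : c * b = 1
    · rw [eq_inv_of_mul_eq_one_left hb, inv_of_mul_wordProd, len_wordProd h.2.2, len_wordProd h]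
      simp only [List.length_cons]; omega
    · rw [len_of_mul_front h hb]; omega

/-- If multiplication by the inverse of `c` shortens `x`, then `x` has a reduced word that begins
with `c`. -/
lemma exists_reduced_cons {k : I} {c : G k} {x : S.Product}
    (h : len (S.of k c⁻¹ * x) + 1 = len x) :
    ∃ v, S.Reduced (⟨k, c⟩ :: v) ∧ S.wordProd (⟨k, c⟩ :: v) = x := by
  have hc : c⁻¹ ≠ 1 := by
    intro hc; rw [hc, map_one, one_mul] at h; omega
  rcases of_mul_cases hc x with h' | ⟨b, v, hr, rfl⟩
  · omega
  · by_cases hb : c⁻¹ * b = 1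
    · obtain rfl := inv_mul_eq_one.1 hb
      exact ⟨v, hr, rfl⟩
    · rw [len_of_mul_front hr hb] at h; omega

lemma cayleyGraph_adj {x y : S.Product} :
    S.cayleyGraph.Adj x y ↔ ∃ (k : I) (c : G k), c ≠ 1 ∧ y = x * S.of k c := by
  rw [cayleyGraph, SimpleGraph.mulCayley_adj']
  constructor
  · rintro ⟨hne, g, hg, h⟩
    obtain ⟨k, c, rfl⟩ := Set.mem_iUnion.1 hg
    have hc : c ≠ 1 := by
      rintro rfl
      rw [map_one, mul_one, mul_one] at h
      exact hne (h.elim id id)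
    rcases h with rfl | rfl
    · exact ⟨k, c, hc, rfl⟩
    · exact ⟨k, c⁻¹, inv_ne_one.2 hc, by simp⟩
  · rintro ⟨k, c, hc, rfl⟩
    exact ⟨by simpa using (of_ne_one hc), S.of k c, Set.mem_iUnion.2 ⟨k, c, rfl⟩, Or.inl rfl⟩

lemma exists_walk (x : S.Product) (w : List (Σ i, G i)) (hw : S.Reduced w) :
    ∃ p : S.cayleyGraph.Walk x (x * S.wordProd w), p.length = w.length := by
  induction w generalizing x with
  | nil => exact ⟨SimpleGraph.Walk.nil.copy rfl (by simp),
      by rw [SimpleGraph.Walk.length_copy]; rfl⟩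
  | cons a w ih =>
    obtain ⟨p, hp⟩ := ih (x * S.of a.1 a.2) hw.2.2
    exact ⟨(SimpleGraph.Walk.cons (cayleyGraph_adj.2 ⟨a.1, a.2, hw.1, rfl⟩) p).copy rfl
      (by rw [wordProd_cons, mul_assoc]), by simp [hp]⟩

lemma len_le_length {x y : S.Product} (p : S.cayleyGraph.Walk x y) : len (x⁻¹ * y) ≤ p.length := by
  induction p with
  | nil => simp [len_one]
  | @cons x y z h p ih =>
    obtain ⟨k, c, -, rfl⟩ := cayleyGraph_adj.1 h
    have := len_of_mul_le k c ((x * S.of k c)⁻¹ * z)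
    rw [mul_inv_rev, mul_assoc, mul_inv_cancel_left] at this
    rw [mul_inv_rev, mul_assoc] at ih
    rw [SimpleGraph.Walk.length_cons]
    omega

lemma cayleyGraph_connected : S.cayleyGraph.Connected := by
  refine SimpleGraph.connected_iff_exists_forall_reachable _ |>.2 ⟨1, fun y => ?_⟩
  obtain ⟨w, hw, rfl⟩ := S.exists_reduced y
  obtain ⟨p, -⟩ := exists_walk 1 w hw
  rw [one_mul] at p
  exact ⟨p⟩

lemma cayleyGraph_dist (x y : S.Product) : S.cayleyGraph.dist x y = len (x⁻¹ * y) := by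
  apply le_antisymm
  · obtain ⟨w, hw, h⟩ := S.exists_reduced (x⁻¹ * y)
    obtain ⟨p, hp⟩ := exists_walk x w hw
    have hy : x * S.wordProd w = y := by rw [h, mul_inv_cancel_left]
    rw [← h, len_wordProd hw, ← hp]
    exact (SimpleGraph.dist_le (p.copy rfl hy)).trans_eq (by simp)
  · obtain ⟨p, hp⟩ := cayleyGraph_connected.exists_walk_length_eq_dist x y
    rw [← hp]
    exact len_le_length p

/-- Two neighbours `v`, `w` of `z` that are closer to `u`. -/
lemma exists_swap_of_dist {u z : S.Product} {i j : I} {a : G i} {b : G j}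
    (hv : S.cayleyGraph.dist (z * S.of i a) u + 1 = S.cayleyGraph.dist z u)
    (hw : S.cayleyGraph.dist (z * S.of j b) u + 1 = S.cayleyGraph.dist z u)
    (hne : z * S.of i a ≠ z * S.of j b) :
    ∃ c d r, S.Swap ⟨i, a⟩ c ⟨j, b⟩ d ∧ S.Reduced (⟨i, a⟩ :: c :: r) ∧
      S.wordProd (⟨i, a⟩ :: c :: r) = z⁻¹ * u := by
  simp only [cayleyGraph_dist, mul_inv_rev, mul_assoc, ← map_inv] at hv hw
  obtain ⟨v, hrv, ev⟩ := exists_reduced_cons hv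
  obtain ⟨w, hrw, ew⟩ := exists_reduced_cons hw
  have := hrv.wordEquiv hrw (ev.trans ew.symm)
  -- Reduced words of `z⁻¹ * u` begin with `a` and with `b`. These letters differ, so a single swap
  -- exchanges them.
  rcases this.cons_cons with ⟨e, _⟩ | ⟨d, c, r, hs, h₁, _⟩
  · obtain ⟨rfl, e⟩ := Sigma.mk.inj_iff.1 e
    obtain rfl := eq_of_heq e
    exact absurd rfl hne
  · refine ⟨c, d, r, hs, hrv.congr (.cons _ h₁), ?_⟩
    rw [← ev]
    exact (WordEquiv.cons _ h₁).wordProd_eq.symm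

/-- Prefixing a letter to one whose index is different produces length two. So if a product of two
non-trivial letters is again a non-trivial letter, their indices agree; this is used twice. -/
lemma index_eq_of_triangle {x : S.Product} {i j : I} {a : G i} {b : G j} (ha : a ≠ 1) (hb : b ≠ 1)
    (h : S.cayleyGraph.Adj (x * S.of i a) (x * S.of j b)) : i = j := by
  obtain ⟨k, c, hc, e⟩ := cayleyGraph_adj.1 h
  have e' : S.of i a * S.of k c = S.of j b := by
    rw [mul_assoc] at e; exact (mul_left_cancel e).symm
  have key : ∀ {i j k : I} {a : G i} {b : G j} {c : G k}, a ≠ 1 → b ≠ 1 → c ≠ 1 →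
      S.of i a * S.of k c = S.of j b → i = k := by
    intro i j k a b c ha hb hc e
    rcases of_mul_cases ha (S.of k c) with h | ⟨d, v, hr, e'⟩
    · rw [e, len_of hb, len_of hc] at h; omega
    · have : S.WordEquiv (⟨i, d⟩ :: v) [⟨k, c⟩] := hr.wordEquiv (reduced_singleton hc)
        (by simpa using e')
      have hv : v = [] := by simpa using this.length_eq
      subst hv
      rcases this.cons_cons with ⟨e, _⟩ | ⟨_, _, _, _, h₁, _⟩
      · exact (Sigma.mk.inj_iff.1 e).1
      · cases h₁
  have h₁ := key ha hb hc e'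
  subst h₁
  have e'' : S.of i a⁻¹ * S.of j b = S.of i c := by rw [← e', map_inv, inv_mul_cancel_left]
  exact key (inv_ne_one.2 ha) hc hb e''

lemma cayleyGraph_isWeaklyModular : QuasiMedian.IsWeaklyModular S.cayleyGraph where
  connected := cayleyGraph_connected
  triangle u v w hvw h := by
    obtain ⟨k, c, hc, rfl⟩ := cayleyGraph_adj.1 hvw
    rw [SimpleGraph.dist_comm, SimpleGraph.dist_comm (v := v * _), cayleyGraph_dist,
      cayleyGraph_dist, mul_inv_rev, ← map_inv, mul_assoc] at h
    rcases of_mul_cases (inv_ne_one.2 hc) (v⁻¹ * u) with h' | ⟨b, t, hr, e⟩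
    · omega
    -- A reduced word of `v⁻¹ * u` begins with `b` in the same factor `G k`, so `v * b` lies in the
    -- coset `v G_k` containing both endpoints, one step closer to `u`.
    · refine ⟨v * S.of k b, (cayleyGraph_adj.2 ⟨k, b, hr.1, rfl⟩).symm, ?_, ?_⟩
      · refine cayleyGraph_adj.2 ⟨k, b⁻¹ * c, ?_, by rw [mul_assoc, ← map_mul, mul_inv_cancel_left]⟩
        intro hbc
        obtain rfl := inv_mul_eq_one.1 hbc
        rw [← e, inv_of_mul_wordProd, len_wordProd hr, len_wordProd hr.2.2] at h
        simp at h
      · rw [SimpleGraph.dist_comm, SimpleGraph.dist_comm (v := v), cayleyGraph_dist,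
          cayleyGraph_dist, mul_inv_rev, ← map_inv, mul_assoc, ← e, inv_of_mul_wordProd,
          len_wordProd hr, len_wordProd hr.2.2, List.length_cons]
  quadrangle u z v w hv hw hne h₁ h₂ := by
    obtain ⟨i, a, ha, rfl⟩ := cayleyGraph_adj.1 hv
    obtain ⟨j, b, hb, rfl⟩ := cayleyGraph_adj.1 hw
    simp only [SimpleGraph.dist_comm (u := u)] at h₁ h₂ ⊢
    obtain ⟨c, d, r, hs, hr, e⟩ := exists_swap_of_dist h₁ h₂ hne
    have hm := hs.of_mul_of
    refine ⟨z * S.of i a * S.of c.1 c.2, (cayleyGraph_adj.2 ⟨_, _, hr.2.2.1, rfl⟩).symm, ?_, ?_⟩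
    · rw [mul_assoc, hm, ← mul_assoc]
      refine (cayleyGraph_adj.2 ⟨_, _, fun hd => ha (hs.snd_eq_one.1 hd), rfl⟩).symm
    · have e₁ : (z * S.of i a)⁻¹ * u = S.wordProd (c :: r) := by
        rw [mul_inv_rev, mul_assoc, ← e, wordProd_cons, inv_mul_cancel_left]
      have e₂ : (z * S.of i a * S.of c.1 c.2)⁻¹ * u = S.wordProd r := by
        rw [mul_inv_rev, mul_assoc, e₁, wordProd_cons, inv_mul_cancel_left]
      rw [cayleyGraph_dist, cayleyGraph_dist, e₁, e₂, len_wordProd hr.2.2, len_wordProd hr.2.2.2.2,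
        List.length_cons]
  no_K4_minus a b c d hab hac had hbc hbd hcd := by
    obtain ⟨i, x, hx, rfl⟩ := cayleyGraph_adj.1 hab
    obtain ⟨j, y, hy, rfl⟩ := cayleyGraph_adj.1 hac
    obtain ⟨k, z, hz, rfl⟩ := cayleyGraph_adj.1 had
    obtain rfl := index_eq_of_triangle hx hy hbc
    obtain rfl := index_eq_of_triangle hx hz hbd
    refine cayleyGraph_adj.2 ⟨i, y⁻¹ * z, ?_, by rw [mul_assoc, ← map_mul, mul_inv_cancel_left]⟩
    intro h
    exact hcd (by rw [inv_mul_eq_one.1 h])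
  no_K23 u z v₁ v₂ v₃ huz h₁ h₂ h₃ h₁' h₂' h₃' := by
    by_contra! hne
    obtain ⟨i, a, ha, rfl⟩ := cayleyGraph_adj.1 h₁
    obtain ⟨j, b, hb, rfl⟩ := cayleyGraph_adj.1 h₂
    obtain ⟨k, c, hc, rfl⟩ := cayleyGraph_adj.1 h₃
    have e : ∀ {v}, S.cayleyGraph.Adj v z → S.cayleyGraph.dist v z + 1 = S.cayleyGraph.dist u z := by
      intro v hv
      rw [huz, SimpleGraph.dist_eq_one_iff_adj.2 hv]
    obtain ⟨d, f, r, hs, hr, e₁⟩ := exists_swap_of_dist (e h₁') (e h₂') hne.1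
    obtain ⟨d', f', r', hs', hr', e₂⟩ := exists_swap_of_dist (e h₁') (e h₃') hne.2.1
    have hl : ∀ {l : List (Σ i, G i)}, S.Reduced l → S.wordProd l = u⁻¹ * z → l.length = 2 := by
      intro l hl hz
      rw [← len_wordProd hl, hz, ← cayleyGraph_dist, huz]
    have hr0 : r = [] := by simpa using hl hr e₁
    have hr0' : r' = [] := by simpa using hl hr' e₂
    subst hr0 hr0'
    -- Both words are reduced words of `u⁻¹ * z` of length two beginning with `a`, so their second
    -- letters agree. The swap then determines the other front letter, whence `v₂ = v₃`.
    have hdd : d = d' := by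
      rcases (hr.wordEquiv hr' (e₁.trans e₂.symm)).cons_cons with ⟨_, h⟩ | ⟨_, _, _, h, _⟩
      · rcases h.cons_cons with ⟨h, _⟩ | ⟨_, _, _, _, h, _⟩
        · exact h
        · cases h
      · exact absurd rfl h.linked.ne
    subst hdd
    have := (hs.unique hs').1
    obtain ⟨rfl, e⟩ := Sigma.mk.inj_iff.1 this
    obtain rfl := eq_of_heq e
    exact hne.2.2 rfl

/-- The indices label the edges that leave one vertex of the prism. Two directions span a square
whose far corner is at distance two, so the two edges begin reduced words of the same element and
their labels are exchanged by a swap. -/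
lemma linked_of_hasPrism {n : ℕ} (h : QuasiMedian.HasPrism S.cayleyGraph n) :
    ∃ i : Fin n → I, ∀ r s, r ≠ s → Linked (i r) (i s) := by
  obtain ⟨α, φ, hα, -⟩ := h
  choose f g hfg using fun i => exists_pair_ne (α i)
  have hadj : ∀ (p : ∀ i, α i) (i : Fin n) (t : α i), p i ≠ t →
      S.cayleyGraph.Adj (φ p) (φ (Function.update p i t)) := by
    intro p i t ht
    refine φ.map_rel_iff.2 ⟨i, by simpa using ht, fun j hj => ?_⟩
    by_contra hji
    simp [Function.update_of_ne hji] at hj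
  choose k c hc e using fun i => cayleyGraph_adj.1 (hadj f i (g i) (hfg i))
  refine ⟨k, fun r s hrs => ?_⟩
  set z := Function.update (Function.update f r (g r)) s (g s) with hz
  have hz' : z = Function.update (Function.update f s (g s)) r (g r) :=
    Function.update_comm hrs.symm _ _ _ |>.symm ▸ rfl
  have h₁ := hadj (Function.update f r (g r)) s (g s) (by
    rw [Function.update_of_ne hrs.symm]; exact hfg s)
  have h₂ := hadj (Function.update f s (g s)) r (g r) (by
    rw [Function.update_of_ne hrs]; exact hfg r)
  rw [← hz] at h₁
  rw [← hz'] at h₂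
  have hzr : f r ≠ z r := by rw [hz']; simpa using hfg r
  have hzs : f s ≠ z s := by rw [hz]; simpa using hfg s
  have hd : S.cayleyGraph.dist (φ f) (φ z) = 2 := by
    apply le_antisymm
    · exact SimpleGraph.dist_le ((hadj f r (g r) (hfg r)).toWalk.append h₁.toWalk)
    · by_contra! hlt
      have : S.cayleyGraph.dist (φ f) (φ z) = 0 ∨ S.cayleyGraph.dist (φ f) (φ z) = 1 := by omega
      rcases this with h | h
      · rw [cayleyGraph_connected.dist_eq_zero_iff] at h
        exact hzr (congrFun (φ.injective h) r)
      · obtain ⟨i, _, hi⟩ := φ.map_rel_iff.1 (SimpleGraph.dist_eq_one_iff_adj.1 h)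
        exact hrs ((hi r hzr).trans (hi s hzs).symm)
  rw [e] at h₁ h₂
  have key : ∀ {v}, S.cayleyGraph.Adj v (φ z) →
      S.cayleyGraph.dist v (φ z) + 1 = S.cayleyGraph.dist (φ f) (φ z) := by
    intro v hv
    rw [hd, SimpleGraph.dist_eq_one_iff_adj.2 hv]
  obtain ⟨_, _, _, hs, _⟩ := exists_swap_of_dist (key h₁) (key h₂) (by
    rw [← e, ← e]
    intro h
    have := congrFun (φ.injective h) r
    rw [Function.update_self, Function.update_of_ne hrs] at this
    exact hfg r this.symm)
  exact hs.linked

lemma cubicalDimension_cayleyGraph_le : QuasiMedian.cubicalDimension S.cayleyGraph ≤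
    ⨆ n ∈ {n : ℕ | ∃ i : Fin n → I, ∀ r s : Fin n, r ≠ s →
      i r < i s ∨ i s < i r ∨ Oposet.Perp (i r) (i s)}, (n : ℕ∞) :=
  iSup₂_le fun n hn => le_iSup₂_of_le n (linked_of_hasPrism hn) le_rfl

end QuandleSystem

/-! ### Cliques, gates and parallelism. -/

namespace QuasiMedian

variable {V : Type u} {X : SimpleGraph V}

/-- The cliques of a graph: the maximal complete subgraphs. -/
abbrev MaxClique (X : SimpleGraph V) : Type u := {C : Set V // Maximal X.IsClique C}

/-- `z` lies on a geodesic from `x` to `y`. -/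
def Btw (X : SimpleGraph V) (x z y : V) : Prop := X.dist x z + X.dist z y = X.dist x y

open Classical in
/-- The gate of `v` in the clique `C`: the vertex of `C` that is closest to `v`. -/
noncomputable def gate (C : MaxClique X) (v : V) : V :=
  if h : ∃ p ∈ C.1, ∀ c ∈ C.1, c ≠ p → X.dist v c = X.dist v p + 1 then h.choose else v

/-- Two cliques are parallel when their gate maps have the same fibres. -/
def Parallel (C D : MaxClique X) : Prop := ∀ v w, gate C v = gate C w ↔ gate D v = gate D w

lemma Parallel.symm {C D : MaxClique X} (h : Parallel C D) : Parallel D C :=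
  fun v w => (h v w).symm

lemma Parallel.trans {C D E : MaxClique X} (h : Parallel C D) (h' : Parallel D E) : Parallel C E :=
  fun v w => (h v w).trans (h' v w)

lemma exists_adj_dist (hX : X.Connected) {u v : V} (h : u ≠ v) :
    ∃ y, X.Adj u y ∧ X.dist y v + 1 = X.dist u v := by
  obtain ⟨p, hp⟩ := hX.exists_walk_length_eq_dist u v
  cases p with
  | nil => exact absurd rfl h
  | @cons _ y _ ha p =>
    refine ⟨y, ha, ?_⟩
    have h₁ := SimpleGraph.dist_le p
    have h₂ := hX.dist_triangle (u := u) (v := y) (w := v)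
    rw [SimpleGraph.dist_eq_one_iff_adj.2 ha] at h₂
    rw [SimpleGraph.Walk.length_cons] at hp
    omega

namespace IsWeaklyModular

lemma dist_le_of_adj (hX : IsWeaklyModular X) {x y : V} (h : X.Adj x y) (u : V) :
    X.dist u x ≤ X.dist u y + 1 := by
  have := hX.connected.dist_triangle (u := u) (v := y) (w := x)
  rwa [SimpleGraph.dist_eq_one_iff_adj.2 h.symm] at this

lemma mem_of_adj (hX : IsWeaklyModular X) {C : MaxClique X} {v w x : V} (hv : v ∈ C.1)
    (hw : w ∈ C.1) (hne : v ≠ w)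
    (hxv : X.Adj x v) (hxw : X.Adj x w) : x ∈ C.1 := by
  have hcl : X.IsClique (insert x C.1) := by
    refine SimpleGraph.isClique_insert.2 ⟨C.2.1, fun c hc hxc => ?_⟩
    by_cases hcv : c = v
    · exact hcv ▸ hxv
    by_cases hcw : c = w
    · exact hcw ▸ hxw
    exact hX.no_K4_minus v w x c (C.2.1 hv hw hne) hxv.symm (C.2.1 hv hc (Ne.symm hcv)) hxw.symm
      (C.2.1 hw hc (Ne.symm hcw)) hxc
  exact C.2.2 hcl (Set.subset_insert _ _) (Set.mem_insert _ _)

/-- The edge together with all common neighbours of its ends: complete because there is no induced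
`K₄⁻`, and then clearly maximal. -/
lemma exists_clique (hX : IsWeaklyModular X) {p q : V} (h : X.Adj p q) :
    ∃ C : MaxClique X, p ∈ C.1 ∧ q ∈ C.1 := by
  refine ⟨⟨{z | z = p ∨ z = q ∨ X.Adj z p ∧ X.Adj z q}, ?_, ?_⟩, Or.inl rfl, Or.inr (Or.inl rfl)⟩
  · rintro a (rfl | rfl | ⟨h₁, h₂⟩) b (rfl | rfl | ⟨h₃, h₄⟩) hab
    · exact absurd rfl hab
    · exact h
    · exact h₃.symm
    · exact h.symm
    · exact absurd rfl hab
    · exact h₄.symm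
    · exact h₁
    · exact h₂
    · exact hX.no_K4_minus p q a b h h₁.symm h₃.symm h₂.symm h₄.symm hab
  · intro T hT hle z hz
    have hp : p ∈ T := hle (Or.inl rfl)
    have hq : q ∈ T := hle (Or.inr (Or.inl rfl))
    by_cases h₁ : z = p
    · exact Or.inl h₁
    by_cases h₂ : z = q
    · exact Or.inr (Or.inl h₂)
    exact Or.inr (Or.inr ⟨hT hz hp h₁, hT hz hq h₂⟩)

lemma clique_eq (hX : IsWeaklyModular X) {C D : MaxClique X} {v w : V} (hne : v ≠ w)
    (hv : v ∈ C.1) (hw : w ∈ C.1)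
    (hv' : v ∈ D.1) (hw' : w ∈ D.1) : C = D := by
  have key : ∀ {C D : MaxClique X}, v ∈ C.1 → w ∈ C.1 → v ∈ D.1 → w ∈ D.1 → C.1 ⊆ D.1 := by
    intro C D hv hw hv' hw' x hx
    by_cases h₁ : x = v
    · exact h₁ ▸ hv'
    by_cases h₂ : x = w
    · exact h₂ ▸ hw'
    exact hX.mem_of_adj hv' hw' hne (C.2.1 hx hv h₁) (C.2.1 hx hw h₂)
  exact Subtype.ext ((key hv hw hv' hw').antisymm (key hv' hw' hv hw))

/-- If two vertices of `C` were nearest to `v`, the triangle condition would give a closer vertex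
adjacent to both, which would belong to `C`. -/
lemma exists_gate (hX : IsWeaklyModular X) (C : MaxClique X) (v : V) :
    ∃ p ∈ C.1, ∀ c ∈ C.1, c ≠ p → X.dist v c = X.dist v p + 1 := by
  have hne : C.1.Nonempty := by
    rw [Set.nonempty_iff_ne_empty]
    intro h
    have := C.2.2 (y := {v}) (SimpleGraph.isClique_singleton v) (by rw [h]; exact bot_le)
    rw [h] at this
    exact this (Set.mem_singleton v)
  obtain ⟨p, hp, hmin⟩ := WellFounded.has_min (measure (X.dist v)).wf C.1 hne
  refine ⟨p, hp, fun c hc hcp => ?_⟩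
  have h₁ : X.dist v p ≤ X.dist v c := not_lt.1 (hmin c hc)
  have hadj := C.2.1 hc hp hcp
  have h₂ := hX.dist_le_of_adj hadj v
  by_contra h₃
  have h₄ : X.dist v p = X.dist v c := by omega
  obtain ⟨x, hxp, hxc, hx⟩ := hX.triangle v p c hadj.symm h₄
  refine hmin x (hX.mem_of_adj hp hc hcp.symm hxp hxc) ?_
  change X.dist v x < X.dist v p
  omega

lemma gate_mem (hX : IsWeaklyModular X) (C : MaxClique X) (v : V) : gate C v ∈ C.1 := by
  have h := hX.exists_gate C v
  rw [gate, dif_pos h]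
  exact h.choose_spec.1

lemma dist_gate (hX : IsWeaklyModular X) {C : MaxClique X} {v c : V} (hc : c ∈ C.1)
    (hne : c ≠ gate C v) :
    X.dist v c = X.dist v (gate C v) + 1 := by
  have h := hX.exists_gate C v
  rw [gate, dif_pos h] at hne ⊢
  exact h.choose_spec.2 c hc hne

lemma gate_eq_of_lt (hX : IsWeaklyModular X) {C : MaxClique X} {v p q : V} (hp : p ∈ C.1)
    (hq : q ∈ C.1)
    (h : X.dist v p < X.dist v q) : gate C v = p := by
  by_contra hne
  have h₁ := hX.dist_gate hp (Ne.symm hne)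
  by_cases hq' : q = gate C v
  · rw [← hq'] at h₁; omega
  · have h₂ := hX.dist_gate hq hq'
    omega

lemma gate_of_mem (hX : IsWeaklyModular X) {C : MaxClique X} {v : V}
    (hv : v ∈ C.1) : gate C v = v := by
  by_contra hne
  have h₁ := hX.dist_gate hv (Ne.symm hne)
  rw [SimpleGraph.dist_self] at h₁
  omega

lemma gate_eq_of_dist_lt (hX : IsWeaklyModular X) {C : MaxClique X} {x y : V} (h : X.Adj x y)
    (hd : X.dist y (gate C x) < X.dist x (gate C x)) : gate C y = gate C x := by
  by_contra hne
  have h₁ := hX.dist_gate (hX.gate_mem C x) (Ne.symm hne)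
  have h₂ := hX.dist_gate (hX.gate_mem C y) hne
  have h₃ := hX.dist_le_of_adj h (gate C y)
  rw [SimpleGraph.dist_comm, SimpleGraph.dist_comm (v := y)] at h₃
  omega

/-- The opposite cliques of an induced square are disjoint. -/
lemma notMem_of_square (hX : IsWeaklyModular X) {x x' y y' : V}
    (h₄ : X.Adj x y) (hn : x' ≠ y) (hn₁ : ¬ X.Adj x y') (hn₁' : x ≠ y') (hn₂ : ¬ X.Adj x' y)
    {C D : MaxClique X} (hx : x ∈ C.1) (hx' : x' ∈ C.1) (hy : y ∈ D.1) (hy' : y' ∈ D.1) {z : V}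
    (hz : z ∈ C.1) : z ∉ D.1 := by
  intro hz'
  have hxD : x ∉ D.1 := fun h => hn₁ (D.2.1 h hy' hn₁')
  have hyC : y ∉ C.1 := fun h => hn₂ (C.2.1 hx' h hn)
  have hzx : z ≠ x := fun h => hxD (h ▸ hz')
  have hzy : z ≠ y := fun h => hyC (h ▸ hz)
  exact hyC (hX.mem_of_adj hx hz hzx.symm h₄.symm (D.2.1 hy hz' hzy.symm))

/-- Every vertex of a clique in an induced square has a neighbour in the opposite clique. -/
lemma exists_adj_of_square (hX : IsWeaklyModular X) {x x' y y' : V} (h₂ : X.Adj x' y')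
    (h₃ : X.Adj y y')
    (h₄ : X.Adj x y) (hn : x' ≠ y) (hn₁ : ¬ X.Adj x y') (hn₁' : x ≠ y') (hn₂ : ¬ X.Adj x' y)
    {C D : MaxClique X} (hx : x ∈ C.1) (hx' : x' ∈ C.1) (hy : y ∈ D.1) (hy' : y' ∈ D.1) {z : V}
    (hz : z ∈ C.1) : ∃ w ∈ D.1, X.Adj z w := by
  by_cases hzx : z = x
  · exact ⟨y, hy, hzx ▸ h₄⟩
  by_cases hzx' : z = x'
  · exact ⟨y', hy', hzx' ▸ h₂⟩
  have hyC : y ∉ C.1 := fun h => hn₂ (C.2.1 hx' h hn)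
  have hy'C : y' ∉ C.1 := fun h => hn₁ (C.2.1 hx h hn₁')
  have key : ∀ {x y : V}, x ∈ C.1 → y ∉ C.1 → z ≠ x → X.Adj x y → X.dist z y = 2 := by
    intro x y hx hy hzx h
    have h₁ := hX.dist_le_of_adj h.symm z
    rw [SimpleGraph.dist_eq_one_iff_adj.2 (C.2.1 hz hx hzx)] at h₁
    have h₂ : X.dist z y ≠ 0 := by
      rw [Ne, hX.connected.dist_eq_zero_iff]
      rintro rfl
      exact hy hz
    have h₃ : X.dist z y ≠ 1 := by
      rw [Ne, SimpleGraph.dist_eq_one_iff_adj]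
      exact fun h' => hy (hX.mem_of_adj hx hz hzx.symm h.symm h'.symm)
    omega
  have e₁ := key hx hyC hzx h₄
  have e₂ := key hx' hy'C hzx' h₂
  obtain ⟨w, hw, hw', hd⟩ := hX.triangle z y y' h₃ (e₁.trans e₂.symm)
  refine ⟨w, hX.mem_of_adj hy hy' h₃.ne hw hw', SimpleGraph.dist_eq_one_iff_adj.1 (by omega)⟩

/-- Otherwise the two gates are equidistant from `v` and at distance two from each other. They have
a common neighbour `r` in `C`, another one `s'` in `D`, and by the quadrangle condition a third one
closer to `v`: a `K₂,₃`. -/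
lemma adj_gate_of_square (hX : IsWeaklyModular X) {x x' y y' : V} (h₁ : X.Adj x x')
    (h₂ : X.Adj x' y') (h₃ : X.Adj y y')
    (h₄ : X.Adj x y) (hn : x' ≠ y) (hn₁ : ¬ X.Adj x y') (hn₁' : x ≠ y') (hn₂ : ¬ X.Adj x' y)
    {C D : MaxClique X} (hx : x ∈ C.1) (hx' : x' ∈ C.1) (hy : y ∈ D.1) (hy' : y' ∈ D.1) (v : V) :
    X.Adj (gate C v) (gate D v) := by
  have hdisj : ∀ {z}, z ∈ C.1 → z ∉ D.1 := fun hz =>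
    hX.notMem_of_square h₄ hn hn₁ hn₁' hn₂ hx hx' hy hy' hz
  obtain ⟨s', hs', hss'⟩ :=
    hX.exists_adj_of_square h₂ h₃ h₄ hn hn₁ hn₁' hn₂ hx hx' hy hy' (hX.gate_mem C v)
  obtain ⟨r, hr, hrr'⟩ :=
    hX.exists_adj_of_square h₂.symm h₁ h₄.symm hn₁'.symm (fun h => hn₂ h.symm) hn.symm
      (fun h => hn₁ h.symm) hy hy' hx hx' (hX.gate_mem D v)
  by_contra hnadj
  have hsr : s' ≠ gate D v := fun h => hnadj (h ▸ hss')
  have hrs : r ≠ gate C v := fun h => hnadj (h ▸ hrr'.symm)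
  have d₁ := hX.dist_gate hs' hsr
  have d₂ := hX.dist_gate hr hrs
  have d₃ := hX.dist_le_of_adj hss'.symm v
  have d₄ := hX.dist_le_of_adj hrr'.symm v
  have hne : gate C v ≠ gate D v := fun h => hdisj (hX.gate_mem C v) (h ▸ hX.gate_mem D v)
  obtain ⟨w, hw, hw', hd⟩ := hX.quadrangle v r (gate C v) (gate D v)
    (C.2.1 hr (hX.gate_mem C v) hrs) hrr'.symm hne (by omega) (by omega)
  have h2 : X.dist (gate C v) (gate D v) = 2 := by
    have e₁ := hX.dist_le_of_adj (D.2.1 hs' (hX.gate_mem D v) hsr).symm (gate C v)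
    rw [SimpleGraph.dist_eq_one_iff_adj.2 hss'] at e₁
    have e₂ : X.dist (gate C v) (gate D v) ≠ 0 := by rwa [Ne, hX.connected.dist_eq_zero_iff]
    have e₃ : X.dist (gate C v) (gate D v) ≠ 1 := by rwa [Ne, SimpleGraph.dist_eq_one_iff_adj]
    omega
  rcases hX.no_K23 (gate C v) (gate D v) r s' w h2 (C.2.1 (hX.gate_mem C v) hr hrs.symm) hss'
    hw.symm hrr'.symm (D.2.1 hs' (hX.gate_mem D v) hsr) hw' with h | h | h
  · exact hdisj hr (h ▸ hs')
  · rw [← h] at hd; omega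
  · rw [← h] at hd; omega

/-- Opposite cliques of an induced square are parallel. -/
lemma parallel_of_square (hX : IsWeaklyModular X) {x x' y y' : V} (h₁ : X.Adj x x')
    (h₂ : X.Adj x' y') (h₃ : X.Adj y y')
    (h₄ : X.Adj x y) (hn : x' ≠ y) (hn₁ : ¬ X.Adj x y') (hn₁' : x ≠ y') (hn₂ : ¬ X.Adj x' y)
    {C D : MaxClique X} (hx : x ∈ C.1) (hx' : x' ∈ C.1) (hy : y ∈ D.1) (hy' : y' ∈ D.1) :
    Parallel C D := by
  have hdisj : ∀ {z}, z ∈ C.1 → z ∉ D.1 := fun hz =>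
    hX.notMem_of_square h₄ hn hn₁ hn₁' hn₂ hx hx' hy hy' hz
  have hadj := hX.adj_gate_of_square h₁ h₂ h₃ h₄ hn hn₁ hn₁' hn₂ hx hx' hy hy'
  intro v w
  constructor
  · intro h
    by_contra hne
    exact hdisj (hX.gate_mem C v)
      (hX.mem_of_adj (hX.gate_mem D v) (hX.gate_mem D w) hne (hadj v) (h ▸ hadj w))
  · intro h
    by_contra hne
    exact hdisj (hX.mem_of_adj (hX.gate_mem C v) (hX.gate_mem C w) hne (hadj v).symm
      (h ▸ (hadj w).symm)) (hX.gate_mem D v)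

/-- An edge separated by `C` is pushed towards `C`: it bounds a square with an edge one step closer
that has the same gates. Opposite cliques of a square are parallel. -/
lemma parallel_aux (hX : IsWeaklyModular X) (n : ℕ) (C : MaxClique X) : ∀ {D : MaxClique X}
    {x x' : V},
    X.dist x (gate C x) = n → X.Adj x x' → gate C x ≠ gate C x' → x ∈ D.1 → x' ∈ D.1 →
    Parallel C D := by
  induction n with
  | zero =>
    intro D x x' hn hadj hne hx hx'
    have d₁ := hX.dist_gate (hX.gate_mem C x) hne
    have d₂ := hX.dist_gate (hX.gate_mem C x') hne.symm
    have d₃ := hX.dist_le_of_adj hadj.symm (gate C x)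
    rw [SimpleGraph.dist_comm, SimpleGraph.dist_comm (v := x)] at d₃
    have e₁ : x = gate C x := hX.connected.dist_eq_zero_iff.1 hn
    have e₂ : x' = gate C x' := hX.connected.dist_eq_zero_iff.1 (by omega)
    rw [hX.clique_eq hadj.ne (C := C) (D := D) (e₁ ▸ hX.gate_mem C x)
        (e₂ ▸ hX.gate_mem C x') hx hx']
    exact fun _ _ => Iff.rfl
  | succ n ih =>
    intro D x x' hn hadj hne hx hx'
    have d₁ := hX.dist_gate (hX.gate_mem C x) hne
    have d₂ := hX.dist_gate (hX.gate_mem C x') hne.symm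
    have d₃ := hX.dist_le_of_adj hadj.symm (gate C x)
    have d₃' := hX.dist_le_of_adj hadj (gate C x')
    rw [SimpleGraph.dist_comm, SimpleGraph.dist_comm (v := x)] at d₃
    rw [SimpleGraph.dist_comm, SimpleGraph.dist_comm (v := x')] at d₃'
    obtain ⟨y, hxy, hy⟩ := exists_adj_dist hX.connected (u := x) (v := gate C x) (by
      intro h; rw [← h, SimpleGraph.dist_self] at hn; omega)
    have gy : gate C y = gate C x := hX.gate_eq_of_dist_lt hxy (by omega)
    have d₄ := hX.dist_gate (v := y) (hX.gate_mem C x') (by rw [gy]; exact hne.symm)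
    rw [gy] at d₄
    obtain ⟨y', hy₁, hy₂, hy₃⟩ := hX.quadrangle (gate C x') x x' y hadj hxy
      (by rintro rfl; omega)
      (by rw [SimpleGraph.dist_comm, SimpleGraph.dist_comm (v := x)]; omega)
      (by rw [SimpleGraph.dist_comm, SimpleGraph.dist_comm (v := x)]; omega)
    rw [SimpleGraph.dist_comm, SimpleGraph.dist_comm (v := x')] at hy₃
    have gy' : gate C y' = gate C x' := hX.gate_eq_of_dist_lt hy₁.symm (by omega)
    obtain ⟨E, hyE, hy'E⟩ := hX.exists_clique hy₂.symm
    refine (ih (D := E) (x := y) (x' := y') (by rw [gy]; omega) hy₂.symm (by rwa [gy, gy'])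
      hyE hy'E).trans ?_
    have f₁ := hX.dist_le_of_adj hxy.symm (gate C x)
    refine (hX.parallel_of_square hadj hy₁.symm hy₂.symm hxy (by rintro rfl; omega) ?_ ?_ ?_
      hx hx' hyE hy'E).symm
    · intro h
      have := hX.dist_le_of_adj h (gate C x')
      rw [SimpleGraph.dist_comm, SimpleGraph.dist_comm (v := y')] at this
      omega
    · rintro rfl; omega
    · intro h
      have := hX.dist_le_of_adj h (gate C x)
      rw [SimpleGraph.dist_comm, SimpleGraph.dist_comm (v := y)] at this
      omega

/-- A clique that separates two vertices of the clique `D` is parallel to `D`. -/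
lemma parallel_of_ne (hX : IsWeaklyModular X) {C D : MaxClique X} {x x' : V} (hx : x ∈ D.1)
    (hx' : x' ∈ D.1)
    (h : gate C x ≠ gate C x') : Parallel C D :=
  hX.parallel_aux _ C rfl (D.2.1 hx hx' fun e => h (e ▸ rfl)) h hx hx'

lemma btw_step_gate (hX : IsWeaklyModular X) {D : MaxClique X} {x x' y : V}
    (hx : x ∈ D.1) (hx' : x' ∈ D.1) (hy : X.dist x' y + 1 = X.dist x y) : gate D y = x' := by
  refine hX.gate_eq_of_lt hx' hx ?_
  rw [SimpleGraph.dist_comm, SimpleGraph.dist_comm (v := x)]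
  omega

/-- A clique is crossed at most once by a geodesic. -/
lemma gate_eq_of_step (hX : IsWeaklyModular X) {C : MaxClique X} {x x' y : V} (h : X.Adj x x')
    (hy : X.dist x' y + 1 = X.dist x y) (hC : gate C x ≠ gate C x') : gate C y = gate C x' := by
  obtain ⟨D, hx, hx'⟩ := hX.exists_clique h
  rw [hX.parallel_of_ne hx hx' hC, hX.gate_of_mem hx']
  exact hX.btw_step_gate hx hx' hy

/-- Walk from `x` to `z`. At the first step that changes the gate in `C`, both `z` and `y` lie in
the sector just entered. -/
lemma gate_of_btw_aux (hX : IsWeaklyModular X) (n : ℕ) (C : MaxClique X) : ∀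
    {x z y : V}, X.dist x z = n → Btw X x z y →
    gate C z = gate C x ∨ gate C z = gate C y := by
  induction n with
  | zero =>
    intro x z y hn _
    rw [hX.connected.dist_eq_zero_iff.1 hn]; exact Or.inl rfl
  | succ n ih =>
    intro x z y hn h
    unfold Btw at h ih
    obtain ⟨x', hadj, hd⟩ := exists_adj_dist hX.connected (u := x) (v := z) (by
      rintro rfl; rw [SimpleGraph.dist_self] at hn; omega)
    have t₁ := hX.connected.dist_triangle (u := x') (v := z) (w := y)
    have t₂ := hX.dist_le_of_adj hadj y
    rw [SimpleGraph.dist_comm, SimpleGraph.dist_comm (v := x')] at t₂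
    by_cases hC : gate C x = gate C x'
    · rw [hC]
      exact ih (by omega) (by omega)
    · rw [hX.gate_eq_of_step hadj hd hC, hX.gate_eq_of_step (y := y) hadj (by omega) hC]
      exact Or.inr rfl

lemma gate_of_btw (hX : IsWeaklyModular X) {x z y : V} (h : Btw X x z y) (C : MaxClique X) :
    gate C z = gate C x ∨ gate C z = gate C y := hX.gate_of_btw_aux _ C rfl h

/-- Walk from `z` to `y`. The clique `D` of the first edge has gates `z` at `z` and `z'` at `y`, so
the hypothesis gives `D` the gate `z` at `x`, and `z'` is farther from `x` than `z`. -/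
lemma btw_of_gate_aux (hX : IsWeaklyModular X) (n : ℕ) : ∀ {x z y : V}, X.dist z y = n →
    (∀ C : MaxClique X, gate C z = gate C x ∨ gate C z = gate C y) → Btw X x z y := by
  induction n with
  | zero =>
    intro x z y hn _
    rw [hX.connected.dist_eq_zero_iff.1 hn]; simp [Btw]
  | succ n ih =>
    intro x z y hn h
    obtain ⟨z', hadj, hd⟩ := exists_adj_dist hX.connected (u := z) (v := y) (by
      rintro rfl; rw [SimpleGraph.dist_self] at hn; omega)
    have h' : Btw X x z' y := ih (by omega) fun C => by
      by_cases hC : gate C z = gate C z'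
      · rw [← hC]; exact h C
      · exact Or.inr (hX.gate_eq_of_step hadj hd hC).symm
    obtain ⟨D, hz, hz'⟩ := hX.exists_clique hadj
    have gx : gate D x = z := by
      have := h D
      rw [hX.gate_of_mem hz, hX.btw_step_gate hz hz' hd] at this
      exact (this.resolve_right hadj.ne).symm
    have e := hX.dist_gate (v := x) hz' (by rw [gx]; exact hadj.ne.symm)
    rw [gx] at e
    unfold Btw at h' ⊢
    omega

/-- Betweenness in terms of gates. -/
lemma btw_iff (hX : IsWeaklyModular X) {x z y : V} :
    Btw X x z y ↔ ∀ C : MaxClique X, gate C z = gate C x ∨ gate C z = gate C y :=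
  ⟨hX.gate_of_btw, hX.btw_of_gate_aux _ rfl⟩

lemma eq_of_gate (hX : IsWeaklyModular X) {x y : V} (h :
    ∀ C : MaxClique X, gate C x = gate C y) : x = y := by
  have : Btw X x y x := hX.btw_iff.2 fun C => Or.inl (h C).symm
  unfold Btw at this
  rw [SimpleGraph.dist_self] at this
  exact hX.connected.dist_eq_zero_iff.1 (by omega)

lemma gate_eq_of_mem (hX : IsWeaklyModular X) {C D : MaxClique X} {v w x : V} (hv : v ∈ D.1)
    (hw : w ∈ D.1) (hne : v ≠ w)
    (hx : x ∈ D.1) (h : gate C v = gate C w) : gate C x = gate C v := by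
  by_contra hC
  have hp := hX.parallel_of_ne hx hv hC
  rw [hp, hX.gate_of_mem hv, hX.gate_of_mem hw] at h
  exact hne h

/-- The sectors of a clique are gated. -/
lemma exists_sector_gate (hX : IsWeaklyModular X) (C : MaxClique X) (x s : V) :
    ∃ g, gate C g = gate C s ∧ ∀ v, gate C v = gate C s → Btw X x g v := by
  obtain ⟨g, hg, hmin⟩ := WellFounded.has_min (measure (X.dist x)).wf
    {v | gate C v = gate C s} ⟨s, rfl⟩
  replace hmin : ∀ v, gate C v = gate C s → X.dist x g ≤ X.dist x v :=
    fun v hv => not_lt.1 (hmin v hv)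
  replace hg : gate C g = gate C s := hg
  refine ⟨g, hg, ?_⟩
  -- Take for `g` a vertex of the sector nearest to `x`, and induct on the distance from `g`. The
  -- delicate case is when the gate `w` of `x` in the clique of the last edge is not `v'`. The
  -- quadrangle condition then yields `t` in the sector, adjacent to `w`. By induction `g` lies
  -- between `x` and `t`, which puts `t`, hence `w`, too close to `g`.
  have key : ∀ n v, X.dist g v = n → gate C v = gate C s → Btw X x g v := by
    intro n
    induction n using Nat.strong_induction_on with
    | _ n ih =>
    intro v hn hv
    by_cases hgv : v = g
    · subst hgv; simp [Btw]
    obtain ⟨v', hadj, hd⟩ := exists_adj_dist hX.connected hgv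
    rw [SimpleGraph.dist_comm, SimpleGraph.dist_comm (u := v)] at hd
    have hmem : ∀ {w}, Btw X g w v → gate C w = gate C s := by
      intro w hw
      rcases hX.gate_of_btw hw C with h | h
      · rw [h, hg]
      · rw [h, hv]
    have hv' : gate C v' = gate C s := hmem (by
      unfold Btw; rw [SimpleGraph.dist_eq_one_iff_adj.2 hadj.symm]; exact hd)
    have e := ih (X.dist g v') (by omega) v' rfl hv'
    obtain ⟨D, hvD, hv'D⟩ := hX.exists_clique hadj
    have hD : ∀ {w}, w ∈ D.1 → gate C w = gate C s := by
      intro w hw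
      rw [hX.gate_eq_of_mem hvD hv'D hadj.ne hw (hv.trans hv'.symm), hv]
    unfold Btw at e ⊢
    by_cases hgD : gate D x = v'
    · have := hX.dist_gate (v := x) hvD (by rw [hgD]; exact hadj.ne)
      rw [hgD] at this
      omega
    exfalso
    have hw := hX.gate_mem D x
    have dw := hX.dist_gate (v := x) hv'D (Ne.symm hgD)
    have gg : gate D g = v' := hX.gate_eq_of_lt hv'D hvD (by omega)
    have dw' := hX.dist_gate (v := g) hw (by rw [gg]; exact hgD)
    rw [gg] at dw'
    have m := hmin _ (hD hw)
    obtain ⟨v'', hadj', hd'⟩ := exists_adj_dist hX.connected (u := v') (v := g) (by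
      rintro rfl; rw [SimpleGraph.dist_self] at e; omega)
    rw [SimpleGraph.dist_comm, SimpleGraph.dist_comm (u := v')] at hd'
    have hv'' : gate C v'' = gate C s := by
      have : Btw X g v'' v' := by
        unfold Btw; rw [SimpleGraph.dist_eq_one_iff_adj.2 hadj'.symm]; exact hd'
      rcases hX.gate_of_btw this C with h | h
      · rw [h, hg]
      · rw [h, hv']
    have e' := ih (X.dist g v'') (by omega) v'' rfl hv''
    unfold Btw at e'
    obtain ⟨t, ht, ht', htd⟩ := hX.quadrangle x v' v'' (gate D x) hadj'
      (D.2.1 hv'D hw (Ne.symm hgD)) (by intro h; rw [← h] at dw'; omega) (by omega) (by omega)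
    have h2 : X.dist v'' (gate D x) = 2 := by
      have f₁ := hX.connected.dist_triangle (u := g) (v := v'') (w := gate D x)
      have f₂ := hX.dist_le_of_adj ht'.symm v''
      rw [SimpleGraph.dist_eq_one_iff_adj.2 ht.symm] at f₂
      omega
    have htb : Btw X v'' t (gate D x) := by
      unfold Btw
      rw [SimpleGraph.dist_eq_one_iff_adj.2 ht.symm, SimpleGraph.dist_eq_one_iff_adj.2 ht', h2]
    have htC : gate C t = gate C s := by
      rcases hX.gate_of_btw htb C with h | h
      · rw [h, hv'']
      · rw [h, hD hw]
    have f₁ := hX.dist_le_of_adj ht g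
    have e'' := ih (X.dist g t) (by omega) t rfl htC
    unfold Btw at e''
    have f₂ := hX.dist_le_of_adj ht'.symm g
    omega
  exact fun v hv => key _ v rfl hv

end IsWeaklyModular

/-! ### Smallest median triples and tripods. -/

/-- A triple is a tripod when every clique has either one gate or three gates for it. -/
def IsTripod (X : SimpleGraph V) (y : Fin 3 → V) : Prop := ∀ C : MaxClique X,
  (∀ i j, gate C (y i) = gate C (y j)) ∨ ∀ i j, i ≠ j → gate C (y i) ≠ gate C (y j)

lemma exists_isSmallestMedianTriple (x : Fin 3 → V) : ∃ y, IsSmallestMedianTriple X x y := by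
  obtain ⟨y, hy, hmin⟩ := WellFounded.has_min (measure (perimeter X)).wf
    {y | IsMedianTriple X x y} ⟨x, fun i j _ => by simp⟩
  exact ⟨y, hy, fun z hz => not_lt.1 (hmin z hz)⟩

lemma perimeter_eq (y : Fin 3 → V) {i j k : Fin 3} (hij : i ≠ j) (hik : i ≠ k) (hjk : j ≠ k) :
    perimeter X y = X.dist (y i) (y j) + X.dist (y i) (y k) + X.dist (y j) (y k) := by
  have h₁ := X.dist_comm (u := y 0) (v := y 1)
  have h₂ := X.dist_comm (u := y 0) (v := y 2)
  have h₃ := X.dist_comm (u := y 1) (v := y 2)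
  unfold perimeter
  fin_cases i <;> fin_cases j <;> fin_cases k <;> simp at hij hik hjk ⊢ <;> omega

lemma eq_or_eq_or_eq {i j k : Fin 3} (hij : i ≠ j) (hik : i ≠ k) (hjk : j ≠ k) (l : Fin 3) :
    l = i ∨ l = j ∨ l = k := by
  omega

lemma isMedianTriple_of_three {x y : Fin 3 → V} {i j k : Fin 3}
    (hij : i ≠ j) (hik : i ≠ k) (hjk : j ≠ k)
    (h₁ : X.dist (x i) (x j) = X.dist (x i) (y i) + X.dist (y i) (y j) + X.dist (y j) (x j))
    (h₂ : X.dist (x i) (x k) = X.dist (x i) (y i) + X.dist (y i) (y k) + X.dist (y k) (x k))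
    (h₃ : X.dist (x j) (x k) = X.dist (x j) (y j) + X.dist (y j) (y k) + X.dist (y k) (x k)) :
    IsMedianTriple X x y := by
  have hs : ∀ {i j}, X.dist (x i) (x j) =
      X.dist (x i) (y i) + X.dist (y i) (y j) + X.dist (y j) (x j) → X.dist (x j) (x i) =
      X.dist (x j) (y j) + X.dist (y j) (y i) + X.dist (y i) (x i) := by
    intro i j h
    rw [X.dist_comm (u := x j), X.dist_comm (u := x j) (v := y j),
      X.dist_comm (u := y j) (v := y i), X.dist_comm (u := y i) (v := x i)]
    omega
  intro a b hab
  rcases eq_or_eq_or_eq hij hik hjk a with rfl | rfl | rfl <;>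
  rcases eq_or_eq_or_eq hij hik hjk b with rfl | rfl | rfl
  · exact absurd rfl hab
  · exact h₁
  · exact h₂
  · exact hs h₁
  · exact absurd rfl hab
  · exact h₃
  · exact hs h₂
  · exact hs h₃
  · exact absurd rfl hab

namespace IsWeaklyModular

/-- If `C` separates `y i` from the other two vertices, which share a sector, then replacing `y i`
by its gate `g` in that sector keeps a median triple and shortens the perimeter by twice the
distance from `y i` to `g`. -/
lemma gate_ne_of_smallest (hX : IsWeaklyModular X) {x y : Fin 3 → V}
    (hy : IsSmallestMedianTriple X x y) (C : MaxClique X) {i j k : Fin 3}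
    (hij : i ≠ j) (hik : i ≠ k) (hjk : j ≠ k) (h : gate C (y j) = gate C (y k)) :
    gate C (y i) = gate C (y j) := by
  by_contra hne
  obtain ⟨g, hg, hb⟩ := hX.exists_sector_gate C (y i) (y j)
  have b₁ := hb (y j) rfl
  have b₂ := hb (y k) h.symm
  unfold Btw at b₁ b₂
  have hgi : X.dist (y i) g ≠ 0 := by
    rw [Ne, hX.connected.dist_eq_zero_iff]
    rintro rfl
    exact hne hg
  have m₁ := hy.1 i j hij
  have m₂ := hy.1 i k hik
  have t := hX.connected.dist_triangle (u := x i) (v := y i) (w := g)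
  have t₁ := hX.connected.dist_triangle (u := x i) (v := g) (w := x j)
  have t₁' := hX.connected.dist_triangle (u := g) (v := y j) (w := x j)
  have hm : IsMedianTriple X x (Function.update y i g) := by
    refine isMedianTriple_of_three hij hik hjk ?_ ?_ ?_ <;>
      simp only [Function.update_self, Function.update_of_ne hij.symm,
        Function.update_of_ne hik.symm]
    · omega
    · omega
    · exact hy.1 j k hjk
  have := hy.2 _ hm
  rw [perimeter_eq _ hij hik hjk, perimeter_eq _ hij hik hjk] at this
  simp only [Function.update_self, Function.update_of_ne hij.symm,
        Function.update_of_ne hik.symm] at this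
  omega

lemma isTripod_of_smallest (hX : IsWeaklyModular X) {x y : Fin 3 → V}
    (hy : IsSmallestMedianTriple X x y) : IsTripod X y := by
  intro C
  have h₁ := hX.gate_ne_of_smallest hy C
    (i := 0) (j := 1) (k := 2) (by decide) (by decide) (by decide)
  have h₂ := hX.gate_ne_of_smallest hy C
    (i := 1) (j := 0) (k := 2) (by decide) (by decide) (by decide)
  have h₃ := hX.gate_ne_of_smallest hy C
    (i := 2) (j := 0) (k := 1) (by decide) (by decide) (by decide)
  simp only [Fin.forall_fin_succ, ne_eq]
  simp
  grind

lemma gate_of_medianTriple (hX : IsWeaklyModular X) {x y : Fin 3 → V} (hy : IsMedianTriple X x y)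
    (C : MaxClique X) {i j : Fin 3} (hij : i ≠ j) :
    (gate C (y i) = gate C (x i) ∨ gate C (y i) = gate C (x j)) ∧
    (gate C (y i) = gate C (x i) ∨ gate C (y i) = gate C (y j)) := by
  have h := hy i j hij
  have t₁ := hX.connected.dist_triangle (u := x i) (v := y i) (w := x j)
  have t₂ := hX.connected.dist_triangle (u := y i) (v := y j) (w := x j)
  have t₃ := hX.connected.dist_triangle (u := x i) (v := y i) (w := y j)
  have t₄ := hX.connected.dist_triangle (u := x i) (v := y j) (w := x j)
  exact ⟨hX.gate_of_btw (by unfold Btw; omega) C, hX.gate_of_btw (by unfold Btw; omega) C⟩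

/-- A median triple that is a tripod lies between the vertices of any other median triple. -/
lemma gate_of_isTripod (hX : IsWeaklyModular X) {x y z : Fin 3 → V} (hy : IsMedianTriple X x y)
    (ht : IsTripod X y) (hz : IsMedianTriple X x z) (C : MaxClique X) {i j : Fin 3} (hij : i ≠ j) :
    (gate C (y i) = gate C (z i) ∨ gate C (y i) = gate C (z j)) ∧
    (gate C (y j) = gate C (y i) ∨ gate C (y j) = gate C (z j)) := by
  obtain ⟨k, hik, hjk⟩ : ∃ k, i ≠ k ∧ j ≠ k := by
    revert i j; decide
  have y₁ := hX.gate_of_medianTriple hy C hij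
  have y₂ := hX.gate_of_medianTriple hy C hij.symm
  have y₃ := hX.gate_of_medianTriple hy C hik
  have y₄ := hX.gate_of_medianTriple hy C hik.symm
  have y₅ := hX.gate_of_medianTriple hy C hjk
  have y₆ := hX.gate_of_medianTriple hy C hjk.symm
  have z₁ := hX.gate_of_medianTriple hz C hij
  have z₂ := hX.gate_of_medianTriple hz C hij.symm
  have z₃ := hX.gate_of_medianTriple hz C hik
  have z₄ := hX.gate_of_medianTriple hz C hik.symm
  have z₅ := hX.gate_of_medianTriple hz C hjk
  have z₆ := hX.gate_of_medianTriple hz C hjk.symm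
  -- If the gates of `x` are all distinct, `y` and `z` have the gates of `x`. If two of them agree,
  -- the tripod `y` has that majority gate throughout, and `z` has it in at least two places.
  rcases ht C with h | h
  · have e₁ := h i j
    have e₂ := h i k
    grind
  · have e₁ := h i j hij
    have e₂ := h i k hik
    have e₃ := h j k hjk
    grind

/-- Since `y` lies between the vertices of `z`, the perimeter of `z` exceeds that of `y` by twice
the sum of the distances from `z i` to `y i`. -/
lemma existsUnique_smallest (hX : IsWeaklyModular X) {x y : Fin 3 → V}
    (hy : IsSmallestMedianTriple X x y) {z : Fin 3 → V} (hz : IsSmallestMedianTriple X x z) :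
    z = y := by
  have ht := hX.isTripod_of_smallest hy
  have key : ∀ i j, i ≠ j →
      X.dist (z i) (z j) = X.dist (z i) (y i) + X.dist (y i) (y j) + X.dist (z j) (y j) := by
    intro i j hij
    have b₁ : Btw X (z i) (y i) (z j) :=
      hX.btw_iff.2 fun C => (hX.gate_of_isTripod hy.1 ht hz.1 C hij).1
    have b₂ : Btw X (y i) (y j) (z j) :=
      hX.btw_iff.2 fun C => (hX.gate_of_isTripod hy.1 ht hz.1 C hij).2
    unfold Btw at b₁ b₂
    rw [X.dist_comm (u := z j)]
    omega
  have h := hz.2 y hy.1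
  have hij : (0 : Fin 3) ≠ 1 := by decide
  have hik : (0 : Fin 3) ≠ 2 := by decide
  have hjk : (1 : Fin 3) ≠ 2 := by decide
  rw [perimeter_eq _ hij hik hjk, perimeter_eq _ hij hik hjk, key _ _ hij, key _ _ hik,
    key _ _ hjk] at h
  have h0 : X.dist (z 0) (y 0) = 0 := by omega
  have h1 : X.dist (z 1) (y 1) = 0 := by omega
  have h2 : X.dist (z 2) (y 2) = 0 := by omega
  rw [hX.connected.dist_eq_zero_iff] at h0 h1 h2
  funext i
  fin_cases i
  · exact h0
  · exact h1
  · exact h2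

/-! ### Gates as coordinates, and transversality. -/

/-- The quasi-median of three vertices: a vertex whose gates are those of `b` wherever `b` and `c`
agree, and those of `a` elsewhere. -/
lemma exists_quasiMedian (hX : IsWeaklyModular X) (a b c : V) : ∃ m, ∀ C : MaxClique X,
    (gate C b = gate C c → gate C m = gate C b) ∧ (gate C b ≠ gate C c → gate C m = gate C a) := by
  obtain ⟨y, hy⟩ := exists_isSmallestMedianTriple (X := X) ![a, b, c]
  have ht := hX.isTripod_of_smallest hy
  refine ⟨y 0, fun C => ?_⟩
  have hij : (0 : Fin 3) ≠ 1 := by decide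
  have hik : (0 : Fin 3) ≠ 2 := by decide
  have hjk : (1 : Fin 3) ≠ 2 := by decide
  have y₁ := hX.gate_of_medianTriple hy.1 C hij
  have y₂ := hX.gate_of_medianTriple hy.1 C hij.symm
  have y₃ := hX.gate_of_medianTriple hy.1 C hik
  have y₄ := hX.gate_of_medianTriple hy.1 C hik.symm
  have y₅ := hX.gate_of_medianTriple hy.1 C hjk
  have y₆ := hX.gate_of_medianTriple hy.1 C hjk.symm
  simp only [Matrix.cons_val] at y₁ y₂ y₃ y₄ y₅ y₆
  rcases ht C with h | h
  · have e₁ := h 0 1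
    have e₂ := h 0 2
    grind
  · have e₁ := h 0 1 hij
    have e₂ := h 0 2 hik
    have e₃ := h 1 2 hjk
    grind

/-- The cliques crossed by a geodesic. -/
lemma exists_geodesic_cliques (hX : IsWeaklyModular X) (n : ℕ) : ∀ {a b : V}, X.dist a b = n →
    ∃ K : Fin n → MaxClique X, (∀ l, gate (K l) a ≠ gate (K l) b) ∧
      (∀ D : MaxClique X, gate D a ≠ gate D b → ∃ l, Parallel D (K l)) ∧
      ∀ l l', Parallel (K l) (K l') → l = l' := by
  induction n with
  | zero =>
    intro a b h
    obtain rfl := hX.connected.dist_eq_zero_iff.1 h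
    exact ⟨Fin.elim0, fun l => l.elim0, fun D h => absurd rfl h, fun l => l.elim0⟩
  | succ n ih =>
    intro a b h
    obtain ⟨a', hadj, hd⟩ := exists_adj_dist hX.connected (u := a) (v := b) (by
      rintro rfl; rw [SimpleGraph.dist_self] at h; omega)
    obtain ⟨K, hK₁, hK₂, hK₃⟩ := ih (a := a') (b := b) (by omega)
    obtain ⟨D, ha, ha'⟩ := hX.exists_clique hadj
    have hDb := hX.btw_step_gate ha ha' hd
    have hpar : ∀ l, ¬ Parallel D (K l) := fun l hl =>
      hK₁ l ((hl _ _).1 (by rw [hX.gate_of_mem ha', hDb]))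
    refine ⟨Fin.cons D K, ?_, ?_, ?_⟩
    · intro l
      refine Fin.cases ?_ (fun l => ?_) l
      · rw [Fin.cons_zero, hX.gate_of_mem ha, hDb]; exact hadj.ne
      · rw [Fin.cons_succ]
        by_cases hl : gate (K l) a = gate (K l) a'
        · rw [hl]; exact hK₁ l
        · exact absurd (hX.gate_eq_of_step hadj hd hl).symm (hK₁ l)
    · intro E hE
      by_cases hl : gate E a = gate E a'
      · obtain ⟨l, hl⟩ := hK₂ E (hl ▸ hE)
        exact ⟨l.succ, by rwa [Fin.cons_succ]⟩
      · exact ⟨0, by rw [Fin.cons_zero]; exact hX.parallel_of_ne ha ha' hl⟩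
    · intro l l'
      refine Fin.cases ?_ (fun l => ?_) l <;> refine Fin.cases ?_ (fun l' => ?_) l'
      · exact fun _ => rfl
      · rw [Fin.cons_zero, Fin.cons_succ]
        exact fun h => absurd h (hpar l')
      · rw [Fin.cons_zero, Fin.cons_succ]
        exact fun h => absurd h.symm (hpar l)
      · rw [Fin.cons_succ, Fin.cons_succ]
        exact fun h => congrArg _ (hK₃ _ _ h)

/-- A geodesic crosses a separating clique along an edge. -/
lemma exists_crossing (hX : IsWeaklyModular X) (A : MaxClique X) (n : ℕ) : ∀ {a b : V},
    X.dist a b = n → gate A a ≠ gate A b → ∃ u u', X.Adj u u' ∧ Btw X a u b ∧ Btw X a u' b ∧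
      gate A u = gate A a ∧ gate A u' = gate A b := by
  induction n with
  | zero =>
    intro a b h hne
    exact absurd (by rw [hX.connected.dist_eq_zero_iff.1 h]) hne
  | succ n ih =>
    intro a b h hne
    obtain ⟨a', hadj, hd⟩ := exists_adj_dist hX.connected (u := a) (v := b) (by
      rintro rfl; exact hne rfl)
    by_cases hA : gate A a = gate A a'
    · obtain ⟨u, u', h₁, h₂, h₃, h₄, h₅⟩ := ih (a := a') (b := b) (by omega) (hA ▸ hne)
      have key : ∀ {u}, Btw X a' u b → Btw X a u b := by
        intro u hu
        unfold Btw at hu ⊢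
        have t₁ := hX.connected.dist_triangle (u := a) (v := u) (w := b)
        have t₂ := hX.connected.dist_triangle (u := a) (v := a') (w := u)
        rw [SimpleGraph.dist_eq_one_iff_adj.2 hadj] at t₂
        omega
      exact ⟨u, u', h₁, key h₂, key h₃, h₄.trans hA.symm, h₅⟩
    · refine ⟨a, a', hadj, by simp [Btw], ?_, rfl, (hX.gate_eq_of_step hadj hd hA).symm⟩
      unfold Btw
      rw [SimpleGraph.dist_eq_one_iff_adj.2 hadj]
      omega

/-- Two cliques that are not parallel and separate the vertices of a tripod are transverse. -/
lemma exists_transverse (hX : IsWeaklyModular X) {A B : MaxClique X} (hAB : ¬ Parallel A B)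
    {p q r : V} (hA₁ : gate A p ≠ gate A q)
    (hA₃ : gate A q ≠ gate A r) (hB₁ : gate B p ≠ gate B q) (hB₂ : gate B p ≠ gate B r) :
    ∃ w, gate A w = gate A p ∧ gate B w ≠ gate B p := by
  obtain ⟨u, u', hadj, hu, hu', e, e'⟩ := hX.exists_crossing A _ rfl hA₁
  obtain ⟨D, hD, hD'⟩ := hX.exists_clique hadj
  have hBu : gate B u = gate B u' := by
    by_contra h
    exact hAB ((hX.parallel_of_ne hD hD' (by rw [e, e']; exact hA₁)).trans
      (hX.parallel_of_ne hD hD' h).symm)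
  rcases hX.gate_of_btw hu B with h | h
  -- In coordinates given by the gates in `A` and `B`, `u'` is `(q, p)`. The quasi-medians are
  -- successively `(r, p)`, `(r, q)` and `(p, q)`; the last one is the vertex sought.
  · obtain ⟨m₁, h₁⟩ := hX.exists_quasiMedian r u' p
    obtain ⟨m₂, h₂⟩ := hX.exists_quasiMedian q m₁ r
    obtain ⟨m₃, h₃⟩ := hX.exists_quasiMedian p q m₂
    have a₁ := h₁ A
    have a₂ := h₂ A
    have a₃ := h₃ A
    have b₁ := h₁ B
    have b₂ := h₂ B
    have b₃ := h₃ B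
    exact ⟨m₃, by grind, by grind⟩
  · exact ⟨u, e, by rw [h]; exact hB₁.symm⟩

end IsWeaklyModular

/-! ### Convex hulls of tripods. -/

lemma isConvex_hull (S : Set V) : IsConvex X (hull X S) := by
  intro x hx y hy z hz T hT
  exact hT.2 x (hx T hT) y (hy T hT) z hz

lemma subset_hull (S : Set V) : S ⊆ hull X S := fun _ hx _ hT => hT.1 hx

namespace IsWeaklyModular

lemma hull_subset (hX : IsWeaklyModular X) (y : Fin 3 → V) {v : V}
    (hv : v ∈ hull X (Set.range y)) (C : MaxClique X) : ∃ i, gate C v = gate C (y i) := by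
  refine hv {v | ∀ C : MaxClique X, ∃ i, gate C v = gate C (y i)} ⟨?_, ?_⟩ C
  · rintro _ ⟨i, rfl⟩ C
    exact ⟨i, rfl⟩
  · intro a ha b hb z hz C
    rcases hX.gate_of_btw hz C with h | h
    · rw [h]; exact ha C
    · rw [h]; exact hb C

/-- The convex hull of a tripod is a product of complete graphs. -/
lemma isCompleteProduct_hull (hX : IsWeaklyModular X) {y : Fin 3 → V} (ht : IsTripod X y) :
    IsCompleteProduct (X.induce (hull X (Set.range y))) := by
  obtain ⟨K, hK₁, hK₂, hK₃⟩ := hX.exists_geodesic_cliques _ (a := y 0) (b := y 1) rfl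
  have hKt : ∀ l i j, i ≠ j → gate (K l) (y i) ≠ gate (K l) (y j) := fun l =>
    (ht (K l)).resolve_left fun h => hK₁ l (h 0 1)
  have hsep : ∀ {u v}, u ∈ hull X (Set.range y) → v ∈ hull X (Set.range y) →
      ∀ D : MaxClique X, gate D u ≠ gate D v → ∃ l, Parallel D (K l) := by
    intro u v hu hv D h
    obtain ⟨i, hi⟩ := hX.hull_subset y hu D
    obtain ⟨j, hj⟩ := hX.hull_subset y hv D
    refine hK₂ D ?_
    rcases ht D with h' | h'
    · exact absurd (by rw [hi, hj, h' i j]) h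
    · exact h' 0 1 (by decide)
  have hadj : ∀ {u v}, u ∈ hull X (Set.range y) → v ∈ hull X (Set.range y) →
      (X.Adj u v ↔ ∃! l, gate (K l) u ≠ gate (K l) v) := by
    intro u v hu hv
    constructor
    · intro h
      obtain ⟨D, hD, hD'⟩ := hX.exists_clique h
      have hne : gate D u ≠ gate D v := by
        rw [hX.gate_of_mem hD, hX.gate_of_mem hD']; exact h.ne
      obtain ⟨l, hl⟩ := hsep hu hv D hne
      refine ⟨l, fun h => hne ((hl _ _).2 h), fun l' hl' => ?_⟩
      exact hK₃ _ _ ((hX.parallel_of_ne hD hD' hl').trans hl)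
    · rintro ⟨l, hl, huniq⟩
      -- One step from `u` towards `v` already crosses the only class separating them. A clique
      -- separating `u'` from `v` would be parallel to `D`, which does not separate these two.
      obtain ⟨u', h', hd⟩ := exists_adj_dist hX.connected (u := u) (v := v) (by
        rintro rfl; exact hl rfl)
      have hpar : ∀ {D}, gate D u ≠ gate D v → Parallel D (K l) := by
        intro D hD
        obtain ⟨l', hl'⟩ := hsep hu hv D hD
        rw [← huniq l' fun h => hD ((hl' _ _).2 h)]
        exact hl'
      obtain ⟨D, hD, hD'⟩ := hX.exists_clique h'
      have hDv := hX.btw_step_gate hD hD' hd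
      have hDK := hpar (D := D) (by rw [hX.gate_of_mem hD, hDv]; exact h'.ne)
      suffices h : u' = v by rwa [← h]
      refine hX.eq_of_gate fun E => ?_
      by_contra hE
      have hE' : gate E u = gate E u' := by
        by_contra h
        exact hE (hX.gate_eq_of_step h' hd h).symm
      exact hE (((hpar (D := E) (by rwa [hE'])).trans hDK.symm _ _).2
        (by rw [hX.gate_of_mem hD', hDv]))
  -- One coordinate can be changed alone, by taking the gate `g` of `v` in the sector of `y j`. If
  -- another coordinate `l'` changed as well, the whole sector would have the same `l'`-gate as `g`,
  -- against transversality.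
  have hflip : ∀ v ∈ hull X (Set.range y), ∀ l j, ∃ v' ∈ hull X (Set.range y),
      gate (K l) v' = gate (K l) (y j) ∧ ∀ l', l' ≠ l → gate (K l') v' = gate (K l') v := by
    intro v hv l j
    obtain ⟨g, hg, hb⟩ := hX.exists_sector_gate (K l) v (y j)
    refine ⟨g, isConvex_hull _ v hv (y j) (subset_hull _ ⟨j, rfl⟩) g (hb _ rfl), hg, ?_⟩
    intro l' hl'
    by_contra hne
    obtain ⟨p, q, hp, hq, hpq⟩ : ∃ p q : Fin 3, j ≠ p ∧ j ≠ q ∧ p ≠ q := by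
      clear hg hb
      revert j; decide
    obtain ⟨w, hw, hw'⟩ := hX.exists_transverse (fun h => hl' (hK₃ _ _ h).symm)
      (hKt l _ _ hp) (hKt l _ _ hpq) (hKt l' _ _ hp) (hKt l' _ _ hq)
    have e₁ := (hX.gate_of_btw (hb w hw) (K l')).resolve_left hne
    have e₂ := (hX.gate_of_btw (hb (y j) rfl) (K l')).resolve_left hne
    exact hw' (e₁.symm.trans e₂)
  have hsurj : ∀ (f : Fin (X.dist (y 0) (y 1)) → Fin 3) (s : Finset (Fin (X.dist (y 0) (y 1)))),
      ∃ v ∈ hull X (Set.range y), ∀ l ∈ s, gate (K l) v = gate (K l) (y (f l)) := by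
    intro f s
    induction s using Finset.induction_on with
    | empty => exact ⟨y 0, subset_hull _ ⟨0, rfl⟩, by simp⟩
    | insert l s _ ih =>
      obtain ⟨v, hv, h⟩ := ih
      obtain ⟨v', hv', h₁, h₂⟩ := hflip v hv l (f l)
      refine ⟨v', hv', fun l' hl' => ?_⟩
      by_cases hll : l' = l
      · rw [hll, h₁]
      · rw [h₂ l' hll]
        exact h l' ((Finset.mem_insert.1 hl').resolve_left hll)
  -- Each factor is a triangle, with one vertex for each vertex of the tripod; the lift places it in
  -- the universe of `V`.
  choose φ hφ hφK using fun f : Fin (X.dist (y 0) (y 1)) → ULift.{u} (Fin 3) =>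
    hsurj (fun l => (f l).down) Finset.univ
  have hcoord : ∀ f g l, gate (K l) (φ f) = gate (K l) (φ g) ↔ f l = g l := by
    intro f g l
    rw [hφK f l (Finset.mem_univ _), hφK g l (Finset.mem_univ _)]
    constructor
    · intro h
      by_contra hne
      exact hKt l _ _ (fun h => hne (ULift.ext _ _ h)) h
    · intro h; rw [h]
  let e : (∀ _ : Fin (X.dist (y 0) (y 1)), ULift.{u} (Fin 3)) ≃ hull X (Set.range y) :=
    Equiv.ofBijective (fun f => ⟨φ f, hφ f⟩) ⟨by
      intro f g h
      funext l
      exact (hcoord f g l).1 (congrArg (gate (K l)) (Subtype.ext_iff.1 h)), by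
      rintro ⟨v, hv⟩
      choose f hf using fun l => hX.hull_subset y hv (K l)
      refine ⟨fun l => ⟨f l⟩, Subtype.ext (hX.eq_of_gate fun D => ?_)⟩
      by_contra hne
      obtain ⟨l, hl⟩ := hsep (hφ _) hv D hne
      refine hne ((hl _ _).2 ?_)
      rw [hφK _ l (Finset.mem_univ _), hf l]⟩
  refine ⟨_, fun _ => ULift.{u} (Fin 3), ⟨(RelIso.symm ⟨e, ?_⟩ :)⟩⟩
  intro f g
  change X.Adj (φ f) (φ g) ↔ ∃! l, f l ≠ g l
  rw [hadj (hφ f) (hφ g)]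
  simp only [ne_eq, hcoord]

/-- Weakly modular graphs without induced `K₄⁻` and `K₂,₃` are quasi-median. -/
theorem isQuasiMedian (hX : IsWeaklyModular X) : IsQuasiMedian X where
  connected := hX.connected
  no_induced_K4_minus := hX.no_K4_minus
  median_triple x := by
    obtain ⟨y, hy⟩ := exists_isSmallestMedianTriple (X := X) x
    exact ⟨y, ⟨hy, fun z hz => hX.existsUnique_smallest hy hz⟩,
      hX.isCompleteProduct_hull (hX.isTripod_of_smallest hy)⟩

end IsWeaklyModular

end QuasiMedian

theorem theorem3 {I : Type u} [Oposet I] {G : I → Type v} [∀ i, Group (G i)]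
    [∀ i, Nontrivial (G i)] (S : QuandleSystem I G) :
    QuasiMedian.IsQuasiMedian S.cayleyGraph ∧
    QuasiMedian.cubicalDimension S.cayleyGraph ≤
      ⨆ n ∈ {n : ℕ | ∃ i : Fin n → I, ∀ r s : Fin n, r ≠ s →
        i r < i s ∨ i s < i r ∨ Oposet.Perp (i r) (i s)}, (n : ℕ∞) :=
  ⟨QuandleSystem.cayleyGraph_isWeaklyModular.isQuasiMedian,
    QuandleSystem.cubicalDimension_cayleyGraph_le⟩
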